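/- Let $R$ be a commutative Noetherian complete local domain of prime characteristic $p$ which is F-finite (i.e. $R^{1/p}$ is a finitely generated $R$-module), where $R^{1/p^e}$ denotes the ring of $p^e$-th roots of elements of $R$ in an algebraic closure of its fraction field. Let $R \subset S$ be a module-finite extension of commutative rings that is pure, i.e. $R \hookrightarrow S$ splits as a map of $R$-modules. A finitely generated $R$-module is called CM if it is a maximal Cohen–Macaulay $R$-module (the zero module included); an $S$-module or an $R$-algebra is called CM if it is CM as an $R$-module. For a module $M$, $\mathrm{add}(M)$ is the class of modules isomorphic to a direct summand of some $M^{\oplus l}$, $l \ge 0$. The ring $S$ is of finite CM type if there are, up to isomorphism, only finitely many indecomposable CM $S$-modules; a CM generator over $S$ is a CM $S$-module $M$ such that every CM $S$-module lies in $\mathrm{add}(M)$. The ring $R$ is strongly F-regular if for every $0 \ne c \in R$ there is $e \ge 0$ such that the $R$-linear map $R \to R^{1/p^e}$, $1 \mapsto c^{1/p^e}$, splits. For a finitely generated torsion-free $R$-module $N$, $\mathrm{End}_R(N)$ is an NCCR (noncommutative crepant resolution) if it is CM and has finite global dimension. (1) Suppose that $S$ is CM and of finite CM type with a CM generator $M$,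 that $\mathrm{End}_R(M)$ is CM, and that $R$ is strongly F-regular. Then for all sufficiently large $e$, the ring $\mathrm{End}_R(R^{1/p^e})$ is Morita equivalent to $\mathrm{End}_R(M)$ and is an NCCR. (2) In particular, if $S$ is a regular local ring and $\mathrm{End}_R(S)$ is CM, then for all sufficiently large $e$, the ring $\mathrm{End}_R(R^{1/p^e})$ is Morita equivalent to $\mathrm{End}_R(S)$ and is an NCCR. -/

import Mathlib

universe u

/-- An `R`-module `N` over a Noetherian local ring `R` is (maximal) Cohen-Macaulay if it is finitely
generated and there is an `N`-regular sequence of length `dim R` in the maximal ideal of `R`,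
i.e. `depth N ≥ dim R`. The zero module is Cohen-Macaulay; for `N ≠ 0` finitely generated, a weakly
regular sequence in the maximal ideal is regular by Nakayama's lemma. -/
def IsCMModule (R : Type*) [CommRing R] [IsLocalRing R] (N : Type*) [AddCommGroup N]
    [Module R N] : Prop :=
  Module.Finite R N ∧ ∃ rs : List R, (∀ r ∈ rs, r ∈ IsLocalRing.maximalIdeal R) ∧
    ((rs.length : ℕ∞) : WithBot ℕ∞) = ringKrullDim R ∧ RingTheory.Sequence.IsWeaklyRegular N rs

/-- `N` belongs to `add M`: it is isomorphic to a direct summand of `M ^ l` for some `l ≥ 0`. -/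
def InAdd (A : Type*) [Ring A] (M : Type*) [AddCommGroup M] [Module A M]
    (N : Type*) [AddCommGroup N] [Module A N] : Prop :=
  ∃ (l : ℕ) (i : N →ₗ[A] (Fin l → M)) (π : (Fin l → M) →ₗ[A] N), π ∘ₗ i = LinearMap.id

/-- A module is indecomposable if it is nonzero and not the direct sum of two nonzero submodules. -/
def IsIndecomposableModule (A : Type*) [Ring A] (N : Type*) [AddCommGroup N] [Module A N] : Prop :=
  Nontrivial N ∧ ∀ P Q : Submodule A N, IsCompl P Q → P = ⊥ ∨ Q = ⊥

/-- `S` is of finite CM type: up to isomorphism, there are only finitely many indecomposable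
`S`-modules that are Cohen-Macaulay as `R`-modules. -/
def IsOfFiniteCMType (R : Type u) [CommRing R] [IsLocalRing R]
    (S : Type u) [CommRing S] [Algebra R S] : Prop :=
  ∃ (n : ℕ) (X : Fin n → ModuleCat.{u} S),
    ∀ (N : Type u) [AddCommGroup N] [Module R N] [Module S N] [IsScalarTower R S N],
      IsCMModule R N → IsIndecomposableModule S N → ∃ i, Nonempty (N ≃ₗ[S] X i)

/-- `M` is a CM generator over `S`, i.e. an additive generator of the category `CM(S)` of
`S`-modules that are Cohen-Macaulay over `R`: `M` is Cohen-Macaulay, and every Cohen-Macaulay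
`S`-module belongs to `add M`. -/
def IsCMGenerator (R : Type u) [CommRing R] [IsLocalRing R] (S : Type u) [CommRing S] [Algebra R S]
    (M : Type u) [AddCommGroup M] [Module R M] [Module S M] [IsScalarTower R S M] : Prop :=
  IsCMModule R M ∧
    ∀ (N : Type u) [AddCommGroup N] [Module R N] [Module S N] [IsScalarTower R S N],
      IsCMModule R N → InAdd S M N

/-- The extension `R ⊂ S` is pure: `R → S` splits as a map of `R`-modules. -/
def IsPureExtension (R : Type*) [CommRing R] (S : Type*) [CommRing S] [Algebra R S] : Prop :=
  ∃ π : S →ₗ[R] R, π ∘ₗ Algebra.linearMap R S = LinearMap.id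

/-- `R^{1/q} = { f^{1/q} | f ∈ R }` for `q = p ^ e`, inside the algebraic closure of the fraction
field of the domain `R` of characteristic `p`. -/
noncomputable def rootAlgebra (R : Type u) [CommRing R] [IsDomain R] (p : ℕ) [Fact p.Prime]
    [CharP R p] (e : ℕ) : Subalgebra R (AlgebraicClosure (FractionRing R)) :=
  haveI : CharP (AlgebraicClosure (FractionRing R)) p :=
    haveI : FaithfulSMul R (AlgebraicClosure (FractionRing R)) :=
      FaithfulSMul.trans R (FractionRing R) (AlgebraicClosure (FractionRing R))
    charP_of_injective_algebraMap
      (FaithfulSMul.algebraMap_injective R (AlgebraicClosure (FractionRing R))) p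
  { carrier := {x | ∃ f : R, x ^ p ^ e = algebraMap R (AlgebraicClosure (FractionRing R)) f}
    mul_mem' := by
      rintro x y ⟨f, hf⟩ ⟨g, hg⟩
      exact ⟨f * g, by rw [mul_pow, hf, hg, map_mul]⟩
    add_mem' := by
      rintro x y ⟨f, hf⟩ ⟨g, hg⟩
      exact ⟨f + g, by rw [add_pow_char_pow, hf, hg, map_add]⟩
    algebraMap_mem' := fun r => ⟨r ^ p ^ e, by rw [map_pow]⟩ }

/-- `R` is F-finite: `R^{1/p}` is a finitely generated `R`-module. -/
def IsFFinite (R : Type u) [CommRing R] [IsDomain R] (p : ℕ) [Fact p.Prime] [CharP R p] : Prop :=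
  Module.Finite R (rootAlgebra R p 1)

/-- `R` is strongly F-regular: for every `c ≠ 0` there is `q = p ^ e` such that the `R`-linear map
`R → R^{1/q}` with `1 ↦ c^{1/q}` splits. (The element `x` below is the unique `q`-th root of `c`.) -/
def IsStronglyFRegular (R : Type u) [CommRing R] [IsDomain R] (p : ℕ) [Fact p.Prime] [CharP R p] :
    Prop :=
  ∀ c : R, c ≠ 0 → ∃ (e : ℕ) (x : rootAlgebra R p e),
    x ^ p ^ e = algebraMap R (rootAlgebra R p e) c ∧
    ∃ φ : rootAlgebra R p e →ₗ[R] R,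
      φ ∘ₗ LinearMap.toSpanSingleton R (rootAlgebra R p e) x = LinearMap.id

/-- The ring `A` has finite (left) global dimension. -/
def HasFiniteGlobalDimension (A : Type u) [Ring A] : Prop :=
  ∃ n : ℕ, ∀ X : ModuleCat.{u} A, CategoryTheory.HasProjectiveDimensionLE X n

/-- `End_R(M)` is a noncommutative crepant resolution: `M` is a finitely generated torsion-free
`R`-module, and `End_R(M)` is Cohen-Macaulay over `R` and has finite global dimension. -/
def IsNCCR (R : Type u) [CommRing R] [IsLocalRing R] (M : Type u) [AddCommGroup M] [Module R M] :
    Prop :=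
  Module.Finite R M ∧ Module.IsTorsionFree R M ∧ IsCMModule R (Module.End R M) ∧
    HasFiniteGlobalDimension (Module.End R M)

/-!
Write `F^e_* N` for the pushforward of a module along the `e`-th iterate of the Frobenius and
`q = p ^ e`, so that `R^{1/q}` is `F^e_* R` (`rootAlgebraEquiv`). Everything follows once
`add M = add R^{1/q}` over `R` for all large `e`: the rings `End_R(M)` and `End_R(R^{1/q})` are then
Morita equivalent (`isMoritaEquivalent_end`), and `End_R(R^{1/q})` is a summand of a power of
`End_R(M)`, hence Cohen-Macaulay.

* `F^e_* S` is a Cohen-Macaulay `S`-module, so it lies in `add M`, and by purity `F^e_* R` is a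
  summand of it (`IsCMGenerator.inAdd_frobeniusPushforward`).
* For the converse (`IsCMGenerator.exists_forall_inAdd`), a nonzero `c` is chosen such that the
  multiplication by `c` on `M` factors through a free `R`-module. The same `c` then works for every
  Cohen-Macaulay `S`-module, and in particular for `H` with `F^e_* H = Hom_R(M*, F^e_* S)`. Hence on
  `Hom_R(M*, F^e_* S)` the multiplication by `c^{1/q}` factors through a power of `F^e_* R`. By
  strong F-regularity and purity, a map `F^e_* S → R` takes `c^{1/q}` to `1`, and so
  `M = M** = Hom_R(M*, R)` is a retract along that multiplication. Reflexivity of `M` holds because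
  a strongly F-regular ring is normal (`IsStronglyFRegular.isIntegrallyClosed`) and modules of
  maximal depth over a normal domain are reflexive (`HasDepthGE.isReflexive`).
* The global dimension of `End_R(M)` is finite, because a second syzygy over `End_R(M)` has the form
  `Hom_R(N, M)`, and as soon as it is Cohen-Macaulay over `R` it is an `S`-module in `add M`. Then
  `N*` lies in `add M* = add M`, and `Hom_R(N, M) = Hom_R(M*, N*)` is projective
  (`IsCMGenerator.hasFiniteGlobalDimension_end`). Syzygies become Cohen-Macaulay after `dim R`
  steps.

If `S` is a regular local ring, then Cohen-Macaulay `S`-modules are free (`HasDepthGE.free`), and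
`S = Hom_R(R, S)` is a summand of `End_R(S)`, hence Cohen-Macaulay: `S` is a CM generator. The ring
`R` is strongly F-regular since `F^e_* S` is free over `S`, and a given nonzero element of it is
part of a basis when `e` is large (`IsStronglyFRegular.of_isRegularLocalRing`).
-/

open RingTheory.Sequence IsLocalRing CategoryTheory
open scoped Pointwise

/-! ### Direct summands of finite powers -/

section Add

variable {A : Type*} [Ring A] {M N L : Type*} [AddCommGroup M] [Module A M]
  [AddCommGroup N] [Module A N] [AddCommGroup L] [Module A L]

/-- A finite family of maps `N → M → N` whose composites add up to the identity of `N` exhibits `N`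
as a direct summand of a power of `M`. -/
theorem InAdd.of_sum_eq_id {ι : Type*} [Fintype ι] (i : ι → N →ₗ[A] M) (π : ι → M →ₗ[A] N)
    (h : ∀ x, ∑ k, π k (i k x) = x) : InAdd A M N := by
  let e := Fintype.equivFin ι
  refine ⟨Fintype.card ι, LinearMap.pi fun k => i (e.symm k),
    ∑ k, π (e.symm k) ∘ₗ LinearMap.proj k, ?_⟩
  ext x
  simp only [LinearMap.comp_apply, LinearMap.sum_apply, LinearMap.proj_apply, LinearMap.pi_apply,
    LinearMap.id_apply]
  rw [← h x]
  exact Fintype.sum_equiv e.symm _ _ fun k => by simp [h]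

theorem InAdd.exists_sum_eq_id (h : InAdd A M N) : ∃ (l : ℕ) (i : Fin l → N →ₗ[A] M)
    (π : Fin l → M →ₗ[A] N), ∀ x, ∑ k, π k (i k x) = x := by
  obtain ⟨l, i, π, h⟩ := h
  refine ⟨l, fun k => LinearMap.proj k ∘ₗ i, fun k => π ∘ₗ LinearMap.single A (fun _ => M) k, ?_⟩
  intro x
  simp only [LinearMap.comp_apply, LinearMap.proj_apply]
  rw [← map_sum]
  have : ∑ k, LinearMap.single A (fun _ => M) k (i x k) = i x := by
    simpa using Finset.univ_sum_single (i x)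
  rw [this]
  exact LinearMap.congr_fun h x

theorem InAdd.of_retract (i : N →ₗ[A] M) (π : M →ₗ[A] N) (h : ∀ x, π (i x) = x) : InAdd A M N :=
  InAdd.of_sum_eq_id (ι := Unit) (fun _ => i) (fun _ => π) (by simpa using h)

theorem InAdd.of_linearEquiv (e : N ≃ₗ[A] M) : InAdd A M N :=
  InAdd.of_retract e.toLinearMap e.symm.toLinearMap (by simp)

theorem InAdd.refl : InAdd A M M := InAdd.of_linearEquiv (LinearEquiv.refl A M)

theorem InAdd.trans (h₁ : InAdd A M N) (h₂ : InAdd A L M) : InAdd A L N := by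
  obtain ⟨l, i, π, h⟩ := h₁.exists_sum_eq_id
  obtain ⟨m, j, ρ, h'⟩ := h₂.exists_sum_eq_id
  refine InAdd.of_sum_eq_id (ι := Fin l × Fin m) (fun k => j k.2 ∘ₗ i k.1)
    (fun k => π k.1 ∘ₗ ρ k.2) fun x => ?_
  simp only [LinearMap.comp_apply, Fintype.sum_prod_type]
  simp only [← map_sum, h', h]

/-- The powers of `M` lie in `add M`. -/
theorem InAdd.pi (m : ℕ) : InAdd A M (Fin m → M) :=
  InAdd.of_sum_eq_id (ι := Fin m) (fun k => LinearMap.proj k)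
    (fun k => LinearMap.single A (fun _ => M) k) fun x => by
      simpa using Finset.univ_sum_single x

theorem InAdd.finite [Module.Finite A M] (h : InAdd A M N) : Module.Finite A N := by
  obtain ⟨l, i, π, h⟩ := h
  exact Module.Finite.of_surjective π fun x => ⟨i x, LinearMap.congr_fun h x⟩

end Add

section AddComm

variable {R : Type*} [CommRing R] {M N N' : Type*} [AddCommGroup M] [Module R M]
  [AddCommGroup N] [Module R N] [AddCommGroup N'] [Module R N']

theorem InAdd.restrictScalars {S : Type*} [CommRing S] [Algebra R S] [Module S M] [Module S N]
    [IsScalarTower R S M] [IsScalarTower R S N] (h : InAdd S M N) : InAdd R M N := by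
  obtain ⟨l, i, π, h⟩ := h
  exact ⟨l, i.restrictScalars R, π.restrictScalars R,
    LinearMap.ext fun x => LinearMap.congr_fun h x⟩

/-- If `N` and `N'` lie in `add M`, then `Hom(N, N')` lies in `add End(M)`. -/
theorem InAdd.hom (h : InAdd R M N) (h' : InAdd R M N') :
    InAdd R (Module.End R M) (N →ₗ[R] N') := by
  obtain ⟨l, i, π, h⟩ := h.exists_sum_eq_id
  obtain ⟨m, j, ρ, h'⟩ := h'.exists_sum_eq_id
  refine InAdd.of_sum_eq_id (ι := Fin l × Fin m)
    (fun k => (LinearMap.lcomp R M (π k.1)) ∘ₗ (LinearMap.compRight R (j k.2)))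
    (fun k => (LinearMap.lcomp R N' (i k.1)) ∘ₗ (LinearMap.compRight R (ρ k.2))) fun f => ?_
  ext x
  simp [Fintype.sum_prod_type, LinearMap.sum_apply, ← map_sum, h, h']

theorem InAdd.hom_right (X : Type*) [AddCommGroup X] [Module R X] (h : InAdd R M N) :
    InAdd R (X →ₗ[R] M) (X →ₗ[R] N) := by
  obtain ⟨l, i, π, h⟩ := h.exists_sum_eq_id
  refine InAdd.of_sum_eq_id (fun k => LinearMap.compRight R (i k))
    (fun k => LinearMap.compRight R (π k)) fun f => ?_
  ext x
  simp [LinearMap.sum_apply, h]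

theorem InAdd.hom_left (X : Type*) [AddCommGroup X] [Module R X] (h : InAdd R M N) :
    InAdd R (M →ₗ[R] X) (N →ₗ[R] X) := by
  obtain ⟨l, i, π, h⟩ := h.exists_sum_eq_id
  refine InAdd.of_sum_eq_id (fun k => LinearMap.lcomp R X (π k))
    (fun k => LinearMap.lcomp R X (i k)) fun f => ?_
  ext x
  simp [LinearMap.sum_apply, ← map_sum, h]

end AddComm

/-! ### Depth over a local ring -/


/-- `N` has depth at least `n`: there is a weakly `N`-regular sequence of length `n` in the maximal
ideal. With weakly regular sequences the zero module has infinite depth. -/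
def HasDepthGE (R : Type*) [CommRing R] [IsLocalRing R] (N : Type*) [AddCommGroup N] [Module R N]
    (n : ℕ) : Prop :=
  ∃ rs : List R, rs.length = n ∧ (∀ r ∈ rs, r ∈ maximalIdeal R) ∧ IsWeaklyRegular N rs

section Depth

variable {R : Type*} [CommRing R]

theorem RingTheory.Sequence.IsWeaklyRegular.of_inAdd {M N : Type*} [AddCommGroup M] [Module R M]
    [AddCommGroup N] [Module R N] {rs : List R} (h : IsWeaklyRegular M rs) (hN : InAdd R M N) :
    IsWeaklyRegular N rs := by
  obtain ⟨l, i, π, hs⟩ := hN.exists_sum_eq_id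
  clear hN
  induction rs generalizing M N with
  | nil => exact IsWeaklyRegular.nil R N
  | cons r rs ih =>
    rw [isWeaklyRegular_cons_iff] at h ⊢
    refine ⟨?_, ih h.2 (fun k => QuotSMulTop.map r (i k)) (fun k => QuotSMulTop.map r (π k)) ?_⟩
    · rw [isSMulRegular_iff_right_eq_zero_of_smul]
      intro x hx
      rw [← hs x]
      refine Finset.sum_eq_zero fun k _ => ?_
      have : r • i k x = 0 := by rw [← map_smul, hx, map_zero]
      rw [h.1.right_eq_zero_of_smul this, map_zero]
    · intro x
      obtain ⟨x, rfl⟩ := Submodule.mkQ_surjective (r • (⊤ : Submodule R N)) x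
      have : ∀ k, QuotSMulTop.map r (π k) (QuotSMulTop.map r (i k)
          (Submodule.mkQ (r • (⊤ : Submodule R N)) x)) =
          Submodule.mkQ (r • (⊤ : Submodule R N)) (π k (i k x)) := fun k => rfl
      rw [Finset.sum_congr rfl fun k _ => this k, ← map_sum, hs]

variable [IsLocalRing R] {M N : Type*} [AddCommGroup M] [Module R M] [AddCommGroup N] [Module R N]

theorem HasDepthGE.zero : HasDepthGE R N 0 := ⟨[], rfl, by simp, IsWeaklyRegular.nil R N⟩

theorem hasDepthGE_succ_iff {n : ℕ} : HasDepthGE R N (n + 1) ↔ ∃ r ∈ maximalIdeal R,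
    IsSMulRegular N r ∧ HasDepthGE R (QuotSMulTop r N) n := by
  constructor
  · rintro ⟨rs, h₁, h₂, h₃⟩
    match rs, h₁ with
    | r :: rs, h₁ =>
      rw [isWeaklyRegular_cons_iff] at h₃
      exact ⟨r, h₂ r (by simp), h₃.1, rs, by simpa using h₁, fun s hs => h₂ s (by simp [hs]), h₃.2⟩
  · rintro ⟨r, hr, hreg, rs, h₁, h₂, h₃⟩
    refine ⟨r :: rs, by simp [h₁], ?_, (isWeaklyRegular_cons_iff N r rs).2 ⟨hreg, h₃⟩⟩
    rintro s hs
    rcases List.mem_cons.1 hs with rfl | hs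
    exacts [hr, h₂ s hs]

theorem HasDepthGE.of_subsingleton [Subsingleton N] (n : ℕ) : HasDepthGE R N n := by
  induction n generalizing N with
  | zero => exact .zero
  | succ n ih =>
    refine hasDepthGE_succ_iff.2 ⟨0, zero_mem _, fun x y _ => Subsingleton.elim x y, ?_⟩
    have : Subsingleton (QuotSMulTop (0 : R) N) := (Submodule.mkQ_surjective _).subsingleton
    exact ih

theorem isCMModule_iff {n : ℕ} (hn : (n : WithBot ℕ∞) = ringKrullDim R) :
    IsCMModule R N ↔ Module.Finite R N ∧ HasDepthGE R N n := by
  refine and_congr_right fun _ => exists_congr fun rs => ?_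
  rw [← hn]
  have : (((rs.length : ℕ∞) : WithBot ℕ∞) = (n : WithBot ℕ∞)) ↔ rs.length = n := by
    norm_cast
  rw [this]
  tauto

theorem IsCMModule.of_inAdd (h : IsCMModule R M) (hN : InAdd R M N) : IsCMModule R N := by
  obtain ⟨_, rs, h₁, h₂, h₃⟩ := h
  exact ⟨hN.finite, rs, h₁, h₂, h₃.of_inAdd hN⟩

end Depth

/-- Depth drops by exactly one modulo a regular element: this is the independence of the depth of
the choice of a regular sequence, read off from Rees' characterization by the vanishing of `Ext`. -/
theorem HasDepthGE.quotSMulTop {R : Type u} [CommRing R] [IsLocalRing R] [IsNoetherianRing R]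
    {N : Type u} [AddCommGroup N] [Module R N] [Module.Finite R N] {n : ℕ}
    (h : HasDepthGE R N (n + 1)) {a : R} (ha : a ∈ maximalIdeal R) (hreg : IsSMulRegular N a) :
    HasDepthGE R (QuotSMulTop a N) n := by
  cases subsingleton_or_nontrivial N with
  | inl hN =>
    have : Subsingleton (QuotSMulTop a N) := (Submodule.mkQ_surjective _).subsingleton
    exact .of_subsingleton n
  | inr hN =>
    have key : ∀ (M : Type u) [AddCommGroup M] [Module R M] [Module.Finite R M] [Nontrivial M],
        maximalIdeal R • (⊤ : Submodule R M) < ⊤ := fun M _ _ _ _ => by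
      refine lt_top_iff_ne_top.2 fun h => ?_
      exact (Submodule.top_ne_ideal_smul_of_le_jacobson_annihilator
        (IsLocalRing.maximalIdeal_le_jacobson _)) h.symm
    obtain ⟨rs, h₁, h₂, h₃⟩ := h
    have hr : IsRegular N rs := .of_isWeaklyRegular_of_mem_maximalIdeal N h₂ h₃
    have := nontrivial_quotSMulTop_of_mem_maximalIdeal N ha
    have t := (ModuleCat.exists_isRegular_tfae (maximalIdeal R) (n + 1) (ModuleCat.of R N)
      (key N)).out 3 1
    have t' := (ModuleCat.exists_isRegular_tfae (maximalIdeal R) n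
      (ModuleCat.of R (QuotSMulTop a N)) (key _)).out 1 3
    have hext := t.1 ⟨rs, h₁, h₂, hr⟩
    obtain ⟨ss, k₁, k₂, k₃⟩ := t'.1 fun i hi => by
      have zero1 := AddCommGrpCat.isZero_of_iff_subsingleton.mpr (hext i (by omega))
      have zero2 := AddCommGrpCat.isZero_of_iff_subsingleton.mpr (hext (i + 1) (by omega))
      exact AddCommGrpCat.subsingleton_of_isZero <|
        CategoryTheory.ShortComplex.Exact.isZero_of_both_zeros
        ((CategoryTheory.Abelian.Ext.covariant_sequence_exact₃' _
          (IsSMulRegular.smulShortComplex_shortExact (M := ModuleCat.of R N) hreg))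
          i (i + 1) rfl)
        (zero1.eq_zero_of_src _) (zero2.eq_zero_of_tgt _)
    exact ⟨ss, k₁, k₂, k₃.toIsWeaklyRegular⟩

/-! ### Cohen-Macaulay modules over a normal domain are reflexive -/

section AssociatedPrimes

variable {R : Type*} [CommRing R] [IsLocalRing R] [IsNoetherianRing R] {N : Type*} [AddCommGroup N]
  [Module R N]

/-- The depth of a module is at most the dimension of `R ⧸ P` for each associated prime `P`. -/
theorem HasDepthGE.le_ringKrullDim_quotient [Module.Finite R N] {n : ℕ} (h : HasDepthGE R N n)
    {P : Ideal R} (hP : IsAssociatedPrime P N) : (n : WithBot ℕ∞) ≤ ringKrullDim (R ⧸ P) := by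
  induction n generalizing N P with
  | zero =>
    have := hP.isPrime
    exact_mod_cast ringKrullDim_nonneg_of_nontrivial
  | succ n ih =>
    obtain ⟨r, hr, hreg, h⟩ := hasDepthGE_succ_iff.1 h
    have hPp := hP.isPrime
    obtain ⟨_, y, hy⟩ := isAssociatedPrime_iff.1 hP
    have hmem : ∀ s, s ∈ P ↔ s • y = 0 := fun s => by
      rw [hy, Submodule.mem_colon_singleton, Submodule.mem_bot]
    have hrP : r ∉ P := fun hrP => by
      have h0 : y = 0 := hreg.right_eq_zero_of_smul ((hmem r).1 hrP)
      exact hPp.ne_top ((Ideal.eq_top_iff_one P).2 ((hmem 1).2 (by simp [h0])))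
    -- The elements killed by `P` are not all divisible by `r`, by Nakayama's lemma.
    obtain ⟨x, hx, hxr⟩ : ∃ x : N, (∀ s ∈ P, s • x = 0) ∧ x ∉ r • (⊤ : Submodule R N) := by
      by_contra! hcon
      let T : Submodule R N := Submodule.torsionBySet R N P
      have hT : ∀ x, x ∈ T ↔ ∀ s ∈ P, s • x = 0 := fun x => by
        simp [T, Submodule.mem_torsionBySet_iff]
      have hle : T ≤ maximalIdeal R • T := fun x hx => by
        obtain ⟨z, -, rfl⟩ := (Submodule.mem_smul_pointwise_iff_exists _ _ _).1
          (hcon x ((hT x).1 hx))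
        refine Submodule.smul_mem_smul hr ((hT z).2 fun s hs => ?_)
        refine hreg.right_eq_zero_of_smul ?_
        rw [smul_comm]
        exact (hT _).1 hx s hs
      have hbot : T = ⊥ := Submodule.eq_bot_of_le_smul_of_le_jacobson_bot _ T
        (IsNoetherian.noetherian T) hle (IsLocalRing.maximalIdeal_le_jacobson _)
      have hyT : y ∈ T := (hT y).2 fun s hs => (hmem s).1 hs
      rw [hbot, Submodule.mem_bot] at hyT
      exact hPp.ne_top ((Ideal.eq_top_iff_one P).2 ((hmem 1).2 (by simp [hyT])))
    have hne : (Submodule.mkQ (r • (⊤ : Submodule R N)) x : QuotSMulTop r N) ≠ 0 := by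
      rwa [Ne, Submodule.mkQ_apply, Submodule.Quotient.mk_eq_zero]
    obtain ⟨Q, hQ, hle⟩ := exists_le_isAssociatedPrime_of_isNoetherianRing R _ hne
    have hQ' : ∀ s : R, s • x ∈ r • (⊤ : Submodule R N) → s ∈ Q := fun s hs => hle <| by
      rw [Submodule.mem_colon_singleton, Submodule.mem_bot, ← map_smul, Submodule.mkQ_apply,
        Submodule.Quotient.mk_eq_zero]
      exact hs
    have hPQ : P ≤ Q := fun s hs => hQ' s (by rw [hx s hs]; exact zero_mem _)
    have hrQ : r ∈ Q := hQ' r (Submodule.smul_mem_pointwise_smul x r ⊤ trivial)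
    have hlt : ringKrullDim (R ⧸ Q) + 1 ≤ ringKrullDim (R ⧸ P) :=
      ringKrullDim_succ_le_of_surjective (Ideal.Quotient.factor hPQ)
        (Ideal.Quotient.factor_surjective hPQ) (r := Ideal.Quotient.mk P r)
        (mem_nonZeroDivisors_of_ne_zero (by rwa [Ne, Ideal.Quotient.eq_zero_iff_mem]))
        (by rw [Ideal.Quotient.factor_mk, Ideal.Quotient.eq_zero_iff_mem]; exact hrQ)
    refine le_trans ?_ hlt
    push_cast
    gcongr
    exact ih h hQ

/-- Passing to the quotient by a larger prime lowers the dimension. -/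
theorem ringKrullDim_quotient_succ_le_of_lt {R : Type*} [CommRing R] {P Q : Ideal R} [P.IsPrime]
    (h : P < Q) : ringKrullDim (R ⧸ Q) + 1 ≤ ringKrullDim (R ⧸ P) := by
  obtain ⟨hle, r, hrQ, hrP⟩ := SetLike.lt_iff_le_and_exists.1 h
  exact ringKrullDim_succ_le_of_surjective (Ideal.Quotient.factor hle)
    (Ideal.Quotient.factor_surjective hle) (r := Ideal.Quotient.mk P r)
    (mem_nonZeroDivisors_of_ne_zero (by rwa [Ne, Ideal.Quotient.eq_zero_iff_mem]))
    (by rw [Ideal.Quotient.factor_mk, Ideal.Quotient.eq_zero_iff_mem]; exact hrQ)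

/-- A module of maximal depth over a local domain is torsion-free. -/
theorem HasDepthGE.isTorsionFree [IsDomain R] [Module.Finite R N] {n : ℕ}
    (hn : (n : WithBot ℕ∞) = ringKrullDim R) (h : HasDepthGE R N n) :
    Module.IsTorsionFree R N := by
  refine ⟨fun r hr => ?_⟩
  by_contra hreg
  have hmem : r ∈ ⋃ p ∈ associatedPrimes R N, (p : Set R) := by
    rw [biUnion_associatedPrimes_eq_compl_regular R]
    exact hreg
  simp only [Set.mem_iUnion] at hmem
  obtain ⟨P, hP, hrP⟩ := hmem
  have hPp : P.IsPrime := IsAssociatedPrime.isPrime hP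
  have h1 := h.le_ringKrullDim_quotient hP
  have hlt : (⊥ : Ideal R) < P := by
    rw [bot_lt_iff_ne_bot]
    rintro rfl
    exact hr.ne_zero hrP
  have h2 := ringKrullDim_quotient_succ_le_of_lt hlt
  rw [ringKrullDim_eq_of_ringEquiv (RingEquiv.quotientBot R), ← hn] at h2
  have h3 : ((n : WithBot ℕ∞)) + 1 ≤ n := le_trans (by gcongr) h2
  have h4 : n + 1 ≤ n := by exact_mod_cast h3
  omega

end AssociatedPrimes

section FactorsThroughFree

variable (R : Type*) [CommRing R] (N : Type*) [AddCommGroup N] [Module R N]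

/-- The multiplication by `s` on `N` factors through a free module of finite rank, that is, it is a
finite sum of maps `x ↦ f x • y` with `f` a linear form on `N` and `y` an element of `N`. -/
def FactorsThroughFree (s : R) : Prop :=
  ∃ (m : ℕ) (f : Fin m → N →ₗ[R] R) (y : Fin m → N), ∀ x, ∑ i, f i x • y i = s • x

variable {R N}

/-- If `N` is free at the prime `P`, then some element outside `P` factors through a free module. -/
theorem exists_factorsThroughFree_of_free_localization [IsNoetherianRing R] [Module.Finite R N]
    (P : Ideal R) [P.IsPrime]
    [Module.Free (Localization.AtPrime P) (LocalizedModule P.primeCompl N)] :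
    ∃ s ∉ P, FactorsThroughFree R N s := by
  have : Module.Finite (Localization.AtPrime P) (LocalizedModule P.primeCompl N) :=
    Module.Finite.of_isLocalizedModule P.primeCompl (LocalizedModule.mkLinearMap P.primeCompl N)
  have : Module.FinitePresentation R N := Module.finitePresentation_of_finite R N
  let m := Module.finrank (Localization.AtPrime P) (LocalizedModule P.primeCompl N)
  let e : LocalizedModule P.primeCompl N ≃ₗ[Localization.AtPrime P]
      (Fin m → Localization.AtPrime P) := (Module.finBasis _ _).equivFun
  let e' := e.restrictScalars R
  let μ := LocalizedModule.mkLinearMap P.primeCompl N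
  let ι : (Fin m → R) →ₗ[R] (Fin m → Localization.AtPrime P) :=
    LinearMap.pi fun i => Algebra.linearMap R (Localization.AtPrime P) ∘ₗ LinearMap.proj i
  have : IsLocalizedModule P.primeCompl ι := by
    dsimp only [ι]
    infer_instance
  obtain ⟨f, s, hf⟩ := Module.FinitePresentation.exists_lift_of_isLocalizedModule P.primeCompl ι
    (e'.toLinearMap ∘ₗ μ)
  obtain ⟨g, t, hg⟩ := Module.FinitePresentation.exists_lift_of_isLocalizedModule P.primeCompl μ
    (e'.symm.toLinearMap ∘ₗ ι)
  obtain ⟨w, hw⟩ := Module.Finite.exists_smul_of_comp_eq_of_isLocalizedModule P.primeCompl μ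
    (g ∘ₗ f) ((t * s) • LinearMap.id) <| by
      ext x
      have h1 := LinearMap.congr_fun hg (f x)
      have h2 := LinearMap.congr_fun hf x
      simp only [LinearMap.comp_apply, LinearMap.smul_apply, LinearEquiv.coe_coe] at h1 h2 ⊢
      rw [h1, h2]
      simp only [LinearMap.id_apply, Submonoid.smul_def, map_smul, LinearEquiv.symm_apply_apply,
        mul_smul]
  refine ⟨(w * (t * s) : P.primeCompl), (w * (t * s) : P.primeCompl).2, m,
    fun i => LinearMap.proj i ∘ₗ f, fun i => (w : R) • g (Pi.single i 1), fun x => ?_⟩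
  have h4 : ∑ i, (LinearMap.proj i ∘ₗ f) x • (w : R) • g (Pi.single i 1) = (w : R) • g (f x) := by
    conv_rhs => rw [← Finset.univ_sum_single (f x)]
    rw [map_sum, Finset.smul_sum]
    refine Finset.sum_congr rfl fun i _ => ?_
    rw [smul_comm, ← map_smul, ← Pi.single_smul, smul_eq_mul, mul_one]
    rfl
  rw [h4]
  have h3 := LinearMap.congr_fun hw x
  simpa only [LinearMap.comp_apply, LinearMap.smul_apply, LinearMap.id_apply, Submonoid.smul_def,
    Submonoid.coe_mul, mul_smul] using h3

/-- Over a normal domain a finitely generated torsion-free module is free at each prime of height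
at most one, because the local ring at such a prime is a principal ideal domain. -/
theorem exists_factorsThroughFree_of_forall_eq [IsDomain R] [IsNoetherianRing R]
    [IsIntegrallyClosed R] [Module.Finite R N] [Module.IsTorsionFree R N] (P : Ideal R) [P.IsPrime]
    (hP : ∀ Q : Ideal R, Q.IsPrime → Q ≠ ⊥ → Q ≤ P → Q = P) :
    ∃ s ∉ P, FactorsThroughFree R N s := by
  let A := Localization.AtPrime P
  have : IsDomain A := IsLocalization.isDomain_localization P.primeCompl_le_nonZeroDivisors
  have : IsIntegrallyClosed A :=
    isIntegrallyClosed_of_isLocalization A P.primeCompl P.primeCompl_le_nonZeroDivisors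
  have : Ring.DimensionLEOne A := ⟨by
    intro Q hQ0 hQ
    have hle : Q.under R ≤ P := by
      have h := Ideal.comap_mono (f := algebraMap R A) (le_maximalIdeal hQ.ne_top)
      exact h.trans_eq (IsLocalization.AtPrime.under_maximalIdeal A P)
    have h0 : Q.under R ≠ ⊥ := fun h0 => hQ0 <| by
      rw [← IsLocalization.map_under P.primeCompl A Q, h0, Ideal.map_bot]
    have heq : Q.under R = P := hP _ (hQ.comap _) h0 hle
    have : Q = maximalIdeal A := by
      rw [← IsLocalization.map_under P.primeCompl A Q, heq,
        Localization.AtPrime.map_eq_maximalIdeal]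
    rw [this]
    infer_instance⟩
  have : IsDedekindDomain A := { }
  have : Module.Finite A (LocalizedModule P.primeCompl N) :=
    Module.Finite.of_isLocalizedModule P.primeCompl (LocalizedModule.mkLinearMap P.primeCompl N)
  have : Module.Free A (LocalizedModule P.primeCompl N) := inferInstance
  exact exists_factorsThroughFree_of_free_localization P

/-- An element that factors through a free module kills the cokernel of `N → N**`. -/
theorem FactorsThroughFree.exists_eval_eq {s : R} (h : FactorsThroughFree R N s)
    (φ : Module.Dual R (Module.Dual R N)) : ∃ x, Module.Dual.eval R N x = s • φ := by
  obtain ⟨m, f, y, h⟩ := h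
  refine ⟨∑ i, φ (f i) • y i, LinearMap.ext fun l => ?_⟩
  have hl : s • l = ∑ i, l (y i) • f i := by
    ext x
    rw [LinearMap.smul_apply, ← map_smul, ← h x]
    simp [map_sum, LinearMap.sum_apply, mul_comm]
  rw [LinearMap.smul_apply, ← map_smul, hl]
  simp [Module.Dual.eval_apply, mul_comm]

end FactorsThroughFree

/-- A module of maximal depth over a normal local domain is reflexive. An element of `N** ∖ N` whose
annihilator modulo `N` is a prime `P` produces, for `0 ≠ a ∈ P`, an element of `N / aN` with
annihilator `P`. As `N / aN` has depth at least `dim R - 1`, the prime `P` has height at most one,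
and there `N` is free. -/
theorem HasDepthGE.isReflexive {R : Type u} [CommRing R] [IsDomain R] [IsLocalRing R]
    [IsNoetherianRing R] [IsIntegrallyClosed R] {N : Type u} [AddCommGroup N] [Module R N]
    [Module.Finite R N] {n : ℕ} (hn : (n : WithBot ℕ∞) = ringKrullDim R) (h : HasDepthGE R N n) :
    Module.IsReflexive R N := by
  have htf : Module.IsTorsionFree R N := h.isTorsionFree hn
  have hinj : Function.Injective (Module.Dual.eval R N) := by
    obtain ⟨s, hs, m, f, y, hfg⟩ := exists_factorsThroughFree_of_forall_eq (N := N) (⊥ : Ideal R)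
      fun Q _ h1 h2 => absurd (le_bot_iff.1 h2) h1
    refine (injective_iff_map_eq_zero _).2 fun x hx => ?_
    have hfx : ∀ i, f i x = 0 := fun i => LinearMap.congr_fun hx (f i)
    have := hfg x
    simp only [hfx, zero_smul, Finset.sum_const_zero] at this
    rw [eq_comm] at this
    exact (smul_eq_zero.1 this).resolve_left fun h0 => hs (by simp [h0])
  refine ⟨hinj, ?_⟩
  by_contra hsurj
  let C := Module.Dual R (Module.Dual R N) ⧸ LinearMap.range (Module.Dual.eval R N)
  obtain ⟨φ₀, hφ₀⟩ : ∃ φ, φ ∉ LinearMap.range (Module.Dual.eval R N) := by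
    by_contra! hcon
    exact hsurj fun φ => hcon φ
  obtain ⟨P, hP, -⟩ := exists_le_isAssociatedPrime_of_isNoetherianRing R
    (Submodule.mkQ (LinearMap.range (Module.Dual.eval R N)) φ₀ : C)
    (by rwa [Ne, Submodule.mkQ_apply, Submodule.Quotient.mk_eq_zero])
  have hPp := hP.isPrime
  obtain ⟨_, φ, hφ⟩ := isAssociatedPrime_iff.1 hP
  obtain ⟨φ, rfl⟩ := Submodule.mkQ_surjective _ φ
  have hmem : ∀ s, s ∈ P ↔ ∃ x, Module.Dual.eval R N x = s • φ := fun s => by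
    rw [hφ, Submodule.mem_colon_singleton, Submodule.mem_bot, ← map_smul, Submodule.mkQ_apply,
      Submodule.Quotient.mk_eq_zero, LinearMap.mem_range]
  suffices hQ : ∀ Q : Ideal R, Q.IsPrime → Q ≠ ⊥ → Q ≤ P → Q = P by
    obtain ⟨s, hs, hfac⟩ := exists_factorsThroughFree_of_forall_eq (N := N) P hQ
    exact hs ((hmem s).2 (hfac.exists_eval_eq φ))
  intro Q hQp hQ0 hQP
  by_contra hne
  have hd1 := ringKrullDim_quotient_succ_le_of_lt (lt_of_le_of_ne hQP hne)
  have hd2 := ringKrullDim_quotient_succ_le_of_lt (bot_lt_iff_ne_bot.2 hQ0)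
  rw [ringKrullDim_eq_of_ringEquiv (RingEquiv.quotientBot R), ← hn] at hd2
  obtain ⟨a, haQ, ha0⟩ := Submodule.exists_mem_ne_zero_of_ne_bot hQ0
  have haP := hQP haQ
  have ham : a ∈ maximalIdeal R := le_maximalIdeal hPp.ne_top haP
  have hreg : IsSMulRegular N a := htf.isSMulRegular (.of_ne_zero ha0)
  obtain ⟨x, hx⟩ := (hmem a).1 haP
  have hass : IsAssociatedPrime P (QuotSMulTop a N) := by
    refine isAssociatedPrime_iff.2 ⟨hPp, Submodule.mkQ (a • (⊤ : Submodule R N)) x, ?_⟩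
    ext s
    rw [Submodule.mem_colon_singleton, Submodule.mem_bot, ← map_smul, Submodule.mkQ_apply,
      Submodule.Quotient.mk_eq_zero, Submodule.mem_smul_pointwise_iff_exists, hmem]
    constructor
    · rintro ⟨y, hy⟩
      refine ⟨y, trivial, hinj ?_⟩
      rw [map_smul, map_smul, hy, hx, smul_comm]
    · rintro ⟨y, -, hy⟩
      refine ⟨y, ?_⟩
      have h1 : a • Module.Dual.eval R N y = a • s • φ := by
        rw [← map_smul, hy, map_smul, hx, smul_comm]
      exact smul_right_injective _ ha0 h1
  match n with
  | 0 =>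
    have h3 : ((0 : ℕ) : WithBot ℕ∞) + 1 ≤ (0 : ℕ) :=
      le_trans (by gcongr; exact_mod_cast ringKrullDim_nonneg_of_nontrivial) hd2
    have h4 : 0 + 1 ≤ 0 := by exact_mod_cast h3
    omega
  | n + 1 =>
    have hd := (h.quotSMulTop ham hreg).le_ringKrullDim_quotient hass
    have h3 : ((n : ℕ) : WithBot ℕ∞) + 1 + 1 ≤ (n + 1 : ℕ) :=
      le_trans (by gcongr; exact le_trans (by gcongr) hd1) hd2
    have h4 : n + 1 + 1 ≤ n + 1 := by exact_mod_cast h3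
    omega

/-! ### Pushforward along the Frobenius -/

/-- The pushforward `F^e_* N` of a module along the `e`-th iterate of the Frobenius: the group `N`
with `a` acting as `a ^ p ^ e`. It is a type synonym, a module over every ring that acts on `N`. -/
def FrobeniusPushforward (_p _e : ℕ) (N : Type*) : Type _ := N

namespace FrobeniusPushforward

variable (p e : ℕ) (N : Type*) [AddCommGroup N]

instance : AddCommGroup (FrobeniusPushforward p e N) := inferInstanceAs (AddCommGroup N)

/-- The identity map from `N` to its pushforward. -/
def of : N ≃+ FrobeniusPushforward p e N := AddEquiv.refl N

variable {N}

instance {A : Type*} [CommRing A] [ExpChar A p] [Module A N] :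
    Module A (FrobeniusPushforward p e N) :=
  Module.compHom N (iterateFrobenius A p e)

section

variable {A : Type*} [CommRing A] [ExpChar A p] [Module A N]

theorem smul_of (a : A) (x : N) : a • of p e N x = of p e N (a ^ p ^ e • x) := rfl

theorem of_symm_smul (a : A) (x : FrobeniusPushforward p e N) :
    (of p e N).symm (a • x) = a ^ p ^ e • (of p e N).symm x := rfl

instance {R : Type*} [CommRing R] [ExpChar R p] [Module R N] [Algebra R A] [IsScalarTower R A N] :
    IsScalarTower R A (FrobeniusPushforward p e N) where
  smul_assoc r a x := by
    change (r • a) ^ p ^ e • (of p e N).symm x = r ^ p ^ e • a ^ p ^ e • (of p e N).symm x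
    rw [Algebra.smul_def, mul_pow, mul_smul, ← map_pow, algebraMap_smul]

variable {N' : Type*} [AddCommGroup N'] [Module A N']

/-- The pushforward of a linear map. -/
def map (f : N →ₗ[A] N') : FrobeniusPushforward p e N →ₗ[A] FrobeniusPushforward p e N' where
  toFun x := of p e N' (f ((of p e N).symm x))
  map_add' x y := by simp
  map_smul' a x := by simp [of_symm_smul, smul_of]

@[simp]
theorem map_of (f : N →ₗ[A] N') (x : N) : map p e f (of p e N x) = of p e N' (f x) := rfl

variable (A N)

/-- `F^k_* F^e_* N = F^(k+e)_* N`. -/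
def addEquiv (k : ℕ) : FrobeniusPushforward p (k + e) N ≃ₗ[A]
    FrobeniusPushforward p k (FrobeniusPushforward p e N) where
  toFun x := of p k _ (of p e N ((of p (k + e) N).symm x))
  invFun x := of p (k + e) N ((of p e N).symm ((of p k _).symm x))
  left_inv x := rfl
  right_inv x := rfl
  map_add' x y := rfl
  map_smul' a x := by
    simp [of_symm_smul, smul_of, pow_add, pow_mul]

@[simp]
theorem addEquiv_of (k : ℕ) (x : N) :
    addEquiv p e N A k (of p (k + e) N x) = of p k _ (of p e N x) := rfl

/-- `F^0_* N = N`. -/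
def zeroEquiv : FrobeniusPushforward p 0 N ≃ₗ[A] N where
  toFun x := (of p 0 N).symm x
  invFun x := of p 0 N x
  left_inv x := rfl
  right_inv x := rfl
  map_add' x y := rfl
  map_smul' a x := by simp [of_symm_smul]

/-- The pushforward commutes with finite powers. -/
def piEquiv (m : ℕ) : FrobeniusPushforward p e (Fin m → N) ≃ₗ[A]
    (Fin m → FrobeniusPushforward p e N) where
  toFun x i := of p e N ((of p e _).symm x i)
  invFun x := of p e _ fun i => (of p e N).symm (x i)
  left_inv _ := rfl
  right_inv _ := rfl
  map_add' _ _ := rfl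
  map_smul' _ _ := rfl

variable {A N}

/-- Finiteness of the pushforward of the ring itself along the Frobenius carries over to all finite
modules and all iterates. -/
theorem finite [Module.Finite A N] (hF : Module.Finite A (FrobeniusPushforward p 1 A)) :
    Module.Finite A (FrobeniusPushforward p e N) := by
  have one : ∀ (N : Type _) [AddCommGroup N] [Module A N] [Module.Finite A N],
      Module.Finite A (FrobeniusPushforward p 1 N) := fun N _ _ _ => by
    obtain ⟨m, f, hf⟩ := Module.Finite.exists_fin' A N
    have : Module.Finite A (FrobeniusPushforward p 1 (Fin m → A)) :=
      Module.Finite.equiv (piEquiv p 1 A A m).symm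
    refine Module.Finite.of_surjective (map p 1 f) fun x => ?_
    obtain ⟨y, hy⟩ := hf ((of p 1 N).symm x)
    exact ⟨of p 1 _ y, by rw [map_of, hy]; rfl⟩
  induction e with
  | zero => exact Module.Finite.equiv (zeroEquiv p N A).symm
  | succ e ih =>
    rw [add_comm]
    have := one (FrobeniusPushforward p e N)
    exact Module.Finite.equiv (addEquiv p e N A 1).symm

/-- Generators of the pushforward generate the module itself. -/
theorem finite_of_finite [Module.Finite A (FrobeniusPushforward p e N)] : Module.Finite A N := by
  obtain ⟨s, hs⟩ := Module.Finite.fg_top (R := A) (M := FrobeniusPushforward p e N)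
  refine ⟨Submodule.fg_def.2 ⟨(of p e N).symm '' s, s.finite_toSet.image _, ?_⟩⟩
  rw [eq_top_iff]
  rintro x -
  have hx : of p e N x ∈ Submodule.span A (s : Set (FrobeniusPushforward p e N)) := by
    rw [hs]; trivial
  suffices h : ∀ y ∈ Submodule.span A (s : Set (FrobeniusPushforward p e N)),
      (of p e N).symm y ∈ Submodule.span A ((of p e N).symm '' s) from h _ hx
  intro y hy
  induction hy using Submodule.span_induction with
  | mem y hy => exact Submodule.subset_span ⟨y, hy, rfl⟩
  | zero => exact zero_mem _
  | add y z _ _ hy hz => exact add_mem hy hz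
  | smul a y _ hy =>
    rw [of_symm_smul]
    exact Submodule.smul_mem _ _ hy

variable [IsLocalRing A]

/-- A regular sequence on `F^e_* N` becomes one on `N` after raising its members to powers. -/
theorem hasDepthGE_of_pushforward {n : ℕ} (h : HasDepthGE A (FrobeniusPushforward p e N) n) :
    HasDepthGE A N n := by
  have hp : p ≠ 0 := (expChar_pos A p).ne'
  obtain ⟨rs, h₁, h₂, h₃⟩ := h
  refine ⟨rs.map (· ^ p ^ e), by simpa using h₁, ?_, ?_⟩
  · intro r hr
    obtain ⟨s, hs, rfl⟩ := List.mem_map.1 hr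
    exact Ideal.pow_mem_of_mem _ (h₂ s hs) _ (by positivity)
  · refine (AddEquiv.isWeaklyRegular_congr (e := (of p e N).symm) ?_).1 h₃
    exact List.forall₂_map_right_iff.mpr (List.forall₂_same.mpr fun r _ x => rfl)

end

/-- The pushforward along the Frobenius does not lower the depth. -/
theorem hasDepthGE {A : Type u} [CommRing A] [ExpChar A p] [IsLocalRing A] [IsNoetherianRing A]
    {N : Type u} [AddCommGroup N] [Module A N] [Module.Finite A N] {n : ℕ}
    (h : HasDepthGE A N n) : HasDepthGE A (FrobeniusPushforward p e N) n := by
  have hp : p ≠ 0 := (expChar_pos A p).ne'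
  have key : ∃ rs : List A, rs.length = n ∧ (∀ r ∈ rs, r ∈ maximalIdeal A) ∧
      IsWeaklyRegular N (rs.map (· ^ p ^ e)) := by
    induction n generalizing N with
    | zero => exact ⟨[], rfl, by simp, IsWeaklyRegular.nil A N⟩
    | succ n ih =>
      obtain ⟨r, hr, hreg, -⟩ := hasDepthGE_succ_iff.1 h
      obtain ⟨rs, h₁, h₂, h₃⟩ := ih (h.quotSMulTop
        (Ideal.pow_mem_of_mem _ hr (p ^ e) (by positivity)) (hreg.pow _))
      refine ⟨r :: rs, by simp [h₁], ?_, ?_⟩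
      · intro s hs
        rcases List.mem_cons.1 hs with rfl | hs
        exacts [hr, h₂ s hs]
      · rw [List.map_cons, isWeaklyRegular_cons_iff]
        exact ⟨hreg.pow _, h₃⟩
  obtain ⟨rs, h₁, h₂, h₃⟩ := key
  refine ⟨rs, h₁, h₂, (AddEquiv.isWeaklyRegular_congr (e := (of p e N).symm) ?_).2 h₃⟩
  exact List.forall₂_map_right_iff.mpr (List.forall₂_same.mpr fun r _ x => rfl)

end FrobeniusPushforward

section RootAlgebra

variable (R : Type u) [CommRing R] [IsDomain R] (p : ℕ) [Fact p.Prime] [CharP R p] (e : ℕ)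

/-- Taking `q`-th powers identifies `R^{1/q}` with `R`, the scalar `r` acting as `r ^ q`. -/
theorem exists_rootAlgebraEquiv : ∃ E : rootAlgebra R p e ≃ₗ[R] FrobeniusPushforward p e R,
    ∀ (x : rootAlgebra R p e) (c : R), x ^ p ^ e = algebraMap R (rootAlgebra R p e) c →
      E x = FrobeniusPushforward.of p e R c := by
  let K := AlgebraicClosure (FractionRing R)
  have hfs : FaithfulSMul R K := FaithfulSMul.trans R (FractionRing R) K
  have hinj : Function.Injective (algebraMap R K) := FaithfulSMul.algebraMap_injective R K
  have hchar : CharP K p := charP_of_injective_algebraMap hinj p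
  have hroot : ∀ x : rootAlgebra R p e, ∃ f : R, (x : K) ^ p ^ e = algebraMap R K f := fun x => x.2
  choose g hg using hroot
  let E₀ : rootAlgebra R p e →ₗ[R] FrobeniusPushforward p e R :=
    { toFun := fun x => FrobeniusPushforward.of p e R (g x)
      map_add' := fun x y => by
        rw [← map_add]
        congr 1
        refine hinj ?_
        rw [map_add, ← hg, ← hg, ← hg, Subalgebra.coe_add, add_pow_char_pow]
      map_smul' := fun r x => by
        rw [RingHom.id_apply, FrobeniusPushforward.smul_of]
        congr 1
        refine hinj ?_
        rw [← hg, smul_eq_mul, map_mul, map_pow, ← hg, Subalgebra.coe_smul, Algebra.smul_def,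
          mul_pow] }
  have hbij : Function.Bijective E₀ := by
    refine ⟨fun x y hxy => ?_, fun y => ?_⟩
    · have h1 : g x = g y := hxy
      have h2 : (x : K) ^ p ^ e = (y : K) ^ p ^ e := by rw [hg, hg, h1]
      exact Subtype.ext (iterateFrobenius_inj K p e h2)
    · obtain ⟨z, hz⟩ := IsAlgClosed.exists_pow_nat_eq
        (algebraMap R K ((FrobeniusPushforward.of p e R).symm y))
        (pow_pos (Fact.out : p.Prime).pos e)
      refine ⟨⟨z, _, hz⟩, ?_⟩
      change FrobeniusPushforward.of p e R (g _) = _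
      rw [← AddEquiv.eq_symm_apply]
      refine hinj ?_
      rw [← hg, ← hz]
  refine ⟨LinearEquiv.ofBijective E₀ hbij, fun x c hx => ?_⟩
  change FrobeniusPushforward.of p e R (g x) = _
  congr 1
  refine hinj ?_
  rw [← hg]
  exact congrArg Subtype.val hx

/-- `R^{1/q}` is the pushforward of `R` along the Frobenius, a `q`-th root of `c` being `c`. -/
noncomputable def rootAlgebraEquiv : rootAlgebra R p e ≃ₗ[R] FrobeniusPushforward p e R :=
  (exists_rootAlgebraEquiv R p e).choose

variable {R p e}

theorem rootAlgebraEquiv_apply {x : rootAlgebra R p e} {c : R}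
    (h : x ^ p ^ e = algebraMap R (rootAlgebra R p e) c) :
    rootAlgebraEquiv R p e x = FrobeniusPushforward.of p e R c :=
  (exists_rootAlgebraEquiv R p e).choose_spec x c h

end RootAlgebra

/-! ### Strong F-regularity -/

section StronglyFRegular

variable {R : Type u} [CommRing R] [IsDomain R] {p : ℕ} [Fact p.Prime] [CharP R p]

open FrobeniusPushforward

theorem isStronglyFRegular_iff : IsStronglyFRegular R p ↔ ∀ c : R, c ≠ 0 →
    ∃ (e : ℕ) (φ : FrobeniusPushforward p e R →ₗ[R] R), φ (of p e R c) = 1 := by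
  refine forall₂_congr fun c _ => exists_congr fun e => ?_
  constructor
  · rintro ⟨x, hx, φ, hφ⟩
    refine ⟨φ ∘ₗ (rootAlgebraEquiv R p e).symm.toLinearMap, ?_⟩
    rw [LinearMap.comp_apply, ← rootAlgebraEquiv_apply hx]
    simpa using LinearMap.congr_fun hφ 1
  · rintro ⟨φ, hφ⟩
    obtain ⟨x, hx⟩ : ∃ x : rootAlgebra R p e, x ^ p ^ e = algebraMap R (rootAlgebra R p e) c := by
      obtain ⟨z, hz⟩ := IsAlgClosed.exists_pow_nat_eq
        (algebraMap R (AlgebraicClosure (FractionRing R)) c) (pow_pos (Fact.out : p.Prime).pos e)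
      exact ⟨⟨z, _, hz⟩, Subtype.ext hz⟩
    refine ⟨x, hx, φ ∘ₗ (rootAlgebraEquiv R p e).toLinearMap, ?_⟩
    ext
    simp [rootAlgebraEquiv_apply hx, hφ]

/-- A strongly F-regular domain is normal: if `x = a / b` is integral, then `c x ^ q ∈ R` for some
`c ≠ 0` and all `q`, and a splitting of `1 ↦ c ^ (1 / q)` maps `(c x ^ q) ^ (1 / q)` to `x`. -/
theorem IsStronglyFRegular.isIntegrallyClosed (h : IsStronglyFRegular R p) :
    IsIntegrallyClosed R := by
  rw [isStronglyFRegular_iff] at h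
  refine (isIntegrallyClosed_iff (FractionRing R)).2 fun {x} hx => ?_
  have hx' : IsAlmostIntegral R x := hx.isAlmostIntegral
  obtain ⟨c, hc, hcx⟩ := hx'
  obtain ⟨e, φ, hφ⟩ := h c (nonZeroDivisors.ne_zero hc)
  obtain ⟨d, hd⟩ := hcx (p ^ e)
  obtain ⟨a, b, hb, rfl⟩ := IsFractionRing.div_surjective (A := R) x
  have hb0 : algebraMap R (FractionRing R) b ≠ 0 := by
    simpa using nonZeroDivisors.ne_zero hb
  have hinj := IsFractionRing.injective R (FractionRing R)
  have h1 : a ^ p ^ e * c = b ^ p ^ e * d := by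
    refine hinj ?_
    rw [map_mul, map_mul, hd, Algebra.smul_def, div_pow, map_pow, map_pow]
    field_simp
  have h2 : a = b * φ (of p e R d) := by
    have h3 : a • of p e R c = b • of p e R d := by
      rw [smul_of, smul_of, smul_eq_mul, smul_eq_mul, h1]
    have h4 := congrArg φ h3
    rwa [map_smul, map_smul, hφ, smul_eq_mul, smul_eq_mul, mul_one] at h4
  refine ⟨φ (of p e R d), ?_⟩
  rw [eq_div_iff hb0, ← map_mul, mul_comm, ← h2]

/-- Over a strongly F-regular local domain, the splitting of `1 ↦ c ^ (1 / q)` is available for all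
large `q`. -/
theorem IsStronglyFRegular.exists_forall_splitting [IsLocalRing R] (h : IsStronglyFRegular R p)
    {c : R} (hc : c ≠ 0) : ∃ e₀ : ℕ, ∀ e, e₀ ≤ e →
      ∃ φ : FrobeniusPushforward p e R →ₗ[R] R, φ (of p e R c) = 1 := by
  rw [isStronglyFRegular_iff] at h
  -- `R` is F-split: a splitting for a nonunit `c` occurs at a positive level.
  have hsplit : ∃ ψ : FrobeniusPushforward p 1 R →ₗ[R] R, ψ (of p 1 R 1) = 1 := by
    by_cases hfield : IsField R
    · let := hfield.toField
      obtain ⟨ψ, hψ⟩ := LinearMap.exists_leftInverse_of_injective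
        (LinearMap.toSpanSingleton R (FrobeniusPushforward p 1 R) (of p 1 R 1)) <| by
          rw [LinearMap.ker_eq_bot']
          intro r hr
          rw [LinearMap.toSpanSingleton_apply, smul_of] at hr
          have : r ^ p ^ 1 • (1 : R) = 0 := hr
          simpa [(Fact.out : p.Prime).ne_zero] using this
      exact ⟨ψ, by simpa using LinearMap.congr_fun hψ 1⟩
    · obtain ⟨c, hc, hc0⟩ := Submodule.exists_mem_ne_zero_of_ne_bot
        (fun h0 => hfield (IsLocalRing.isField_iff_maximalIdeal_eq.2 h0))
      obtain ⟨e, φ, hφ⟩ := h c hc0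
      have he : e ≠ 0 := by
        rintro rfl
        have h1 : c • φ (of p 0 R 1) = 1 := by
          rw [← map_smul, smul_of]
          simpa using hφ
        exact (mem_nonunits_iff.1 ((mem_maximalIdeal c).1 hc)) (IsUnit.of_mul_eq_one _ h1)
      obtain ⟨e, rfl⟩ : ∃ k, e = 1 + k := ⟨e - 1, by omega⟩
      let j : R →ₗ[R] FrobeniusPushforward p e R :=
        LinearMap.toSpanSingleton R _ (of p e R 1)
      refine ⟨φ ∘ₗ map p (1 + e) (LinearMap.mulLeft R c) ∘ₗ
        (addEquiv p e R R 1).symm.toLinearMap ∘ₗ map p 1 j, ?_⟩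
      have hj : j 1 = of p e R 1 := by simp [j]
      simp only [LinearMap.comp_apply, map_of, hj, LinearEquiv.coe_coe]
      rw [← addEquiv_of p e R R 1, LinearEquiv.symm_apply_apply, map_of]
      simpa using hφ
  have hsplit' : ∀ k, ∃ ψ : FrobeniusPushforward p k R →ₗ[R] R, ψ (of p k R 1) = 1 := by
    intro k
    induction k with
    | zero => exact ⟨(zeroEquiv p R R).toLinearMap, rfl⟩
    | succ k ih =>
      obtain ⟨ψ, hψ⟩ := ih
      obtain ⟨ψ₁, hψ₁⟩ := hsplit
      refine ⟨ψ ∘ₗ map p k ψ₁ ∘ₗ (addEquiv p 1 R R k).toLinearMap, ?_⟩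
      simp [hψ₁, hψ]
  obtain ⟨e₀, φ, hφ⟩ := h c hc
  refine ⟨e₀, fun e he => ?_⟩
  obtain ⟨k, rfl⟩ := Nat.exists_eq_add_of_le' he
  obtain ⟨ψ, hψ⟩ := hsplit' k
  refine ⟨ψ ∘ₗ map p k φ ∘ₗ (addEquiv p e₀ R R k).toLinearMap, ?_⟩
  simp [hφ, hψ]

end StronglyFRegular

/-! ### Cohen-Macaulay generators and Frobenius pushforwards -/

theorem exists_natCast_eq_ringKrullDim (R : Type*) [CommRing R] [IsLocalRing R]
    [IsNoetherianRing R] : ∃ n : ℕ, (n : WithBot ℕ∞) = ringKrullDim R := by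
  have h1 := ringKrullDim_ne_bot (R := R)
  have h2 := ringKrullDim_ne_top (R := R)
  obtain ⟨d, hd⟩ := WithBot.ne_bot_iff_exists.1 h1
  have hd' : d ≠ ⊤ := by
    rintro rfl
    exact h2 hd.symm
  obtain ⟨n, rfl⟩ := ENat.ne_top_iff_exists.1 hd'
  exact ⟨n, hd⟩

theorem FactorsThroughFree.of_inAdd {R : Type*} [CommRing R] {M N : Type*} [AddCommGroup M]
    [Module R M] [AddCommGroup N] [Module R N] {s : R} (h : FactorsThroughFree R M s)
    (hN : InAdd R M N) : FactorsThroughFree R N s := by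
  obtain ⟨m, f, y, h⟩ := h
  obtain ⟨l, i, π, hs⟩ := hN.exists_sum_eq_id
  refine ⟨l * m, fun k => f (finProdFinEquiv.symm k).2 ∘ₗ i (finProdFinEquiv.symm k).1,
    fun k => π (finProdFinEquiv.symm k).1 (y (finProdFinEquiv.symm k).2), fun x => ?_⟩
  refine (Fintype.sum_equiv finProdFinEquiv.symm _
    (fun k : Fin l × Fin m => (f k.2 (i k.1 x)) • π k.1 (y k.2)) (fun k => rfl)).trans ?_
  simp only [Fintype.sum_prod_type, ← map_smul, ← map_sum, h]
  simp only [map_smul, ← Finset.smul_sum, hs]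

section Generator

variable {R S : Type u} [CommRing R] [IsLocalRing R] [CommRing S] [Algebra R S]
  {M : Type u} [AddCommGroup M] [Module R M] [Module S M] [IsScalarTower R S M]

/-- An `S`-module structure on a Cohen-Macaulay `R`-module, given by a map into its endomorphism
ring, puts the module into `add M` over `R`. -/
theorem IsCMGenerator.inAdd_of_algHom (h : IsCMGenerator R S M) {N : Type u} [AddCommGroup N]
    [Module R N] (hN : IsCMModule R N) (ρ : S →ₐ[R] Module.End R N) : InAdd R M N := by
  let _ : Module S N := Module.compHom N ρ.toRingHom
  have hsmul : ∀ (s : S) (x : N), s • x = ρ s x := fun s x => rfl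
  have : IsScalarTower R S N := ⟨fun r s x => by
    rw [hsmul, hsmul, map_smul, LinearMap.smul_apply]⟩
  exact (h.2 N hN).restrictScalars

/-- The action of `S` on linear maps out of an `S`-module by precomposition. -/
def precompAlgHom (R S M X : Type*) [CommRing R] [CommRing S] [Algebra R S]
    [AddCommGroup M] [Module R M] [Module S M] [IsScalarTower R S M] [AddCommGroup X] [Module R X] :
    S →ₐ[R] Module.End R (M →ₗ[R] X) where
  toFun s := LinearMap.lcomp R X (Algebra.lsmul R R M s)
  map_one' := by ext; simp
  map_mul' s t := by ext; simp [smul_comm s t]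
  map_zero' := by ext; simp
  map_add' s t := by ext; simp
  commutes' r := by ext; simp

/-- If `End_R(M)` is Cohen-Macaulay, then so is `Hom_R(N, N')` for `N, N'` in `add M`; in particular
the dual of the generator is Cohen-Macaulay, and it is an `S`-module. -/
theorem IsCMGenerator.inAdd_dual (h : IsCMGenerator R S M) (hR : InAdd R M R)
    (hEnd : IsCMModule R (Module.End R M)) : InAdd R M (Module.Dual R M) :=
  h.inAdd_of_algHom (hEnd.of_inAdd (InAdd.hom InAdd.refl hR)) (precompAlgHom R S M R)

end Generator

/-- `Hom_R(X, F^e_* N)`, regarded as a module through the values in `N` before the pushforward: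
it is `Hom(F^e* X, N)`. -/
def HomPushforward (R : Type*) [CommRing R] (p e : ℕ) [ExpChar R p] (X N : Type*) [AddCommGroup X]
    [Module R X] [AddCommGroup N] [Module R N] : Type _ :=
  X →ₗ[R] FrobeniusPushforward p e N

namespace HomPushforward

variable (R : Type*) [CommRing R] (p e : ℕ) [ExpChar R p] (X N : Type*) [AddCommGroup X]
    [Module R X] [AddCommGroup N] [Module R N]

instance : AddCommGroup (HomPushforward R p e X N) :=
  inferInstanceAs (AddCommGroup (X →ₗ[R] FrobeniusPushforward p e N))

variable {R X N} in
/-- The map underlying an element of `HomPushforward R p e X N`. -/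
def hom : HomPushforward R p e X N ≃+ (X →ₗ[R] FrobeniusPushforward p e N) := AddEquiv.refl _

instance {A : Type*} [CommRing A] [Algebra R A] [Module A N] [IsScalarTower R A N] :
    Module A (HomPushforward R p e X N) where
  smul a f := (hom p e).symm
    (FrobeniusPushforward.map p e (Algebra.lsmul R R N a) ∘ₗ hom p e f)
  one_smul f := by
    change FrobeniusPushforward.map p e (Algebra.lsmul R R N 1) ∘ₗ hom p e f = f
    rw [map_one]
    rfl
  mul_smul a b f := by
    change FrobeniusPushforward.map p e (Algebra.lsmul R R N (a * b)) ∘ₗ hom p e f =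
      FrobeniusPushforward.map p e (Algebra.lsmul R R N a) ∘ₗ
        FrobeniusPushforward.map p e (Algebra.lsmul R R N b) ∘ₗ hom p e f
    rw [map_mul]
    rfl
  smul_zero a := by
    change FrobeniusPushforward.map p e (Algebra.lsmul R R N a) ∘ₗ
      (0 : X →ₗ[R] FrobeniusPushforward p e N) = 0
    exact LinearMap.comp_zero _
  smul_add a f g := LinearMap.comp_add (hom p e f) (hom p e g)
    (FrobeniusPushforward.map p e (Algebra.lsmul R R N a))
  add_smul a b f := by
    change FrobeniusPushforward.map p e (Algebra.lsmul R R N (a + b)) ∘ₗ hom p e f =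
      FrobeniusPushforward.map p e (Algebra.lsmul R R N a) ∘ₗ hom p e f +
        FrobeniusPushforward.map p e (Algebra.lsmul R R N b) ∘ₗ hom p e f
    rw [map_add]
    rfl
  zero_smul f := by
    change FrobeniusPushforward.map p e (Algebra.lsmul R R N (0 : A)) ∘ₗ hom p e f = 0
    rw [map_zero]
    rfl

theorem hom_smul_apply {A : Type*} [CommRing A] [Algebra R A] [Module A N] [IsScalarTower R A N]
    (a : A) (f : HomPushforward R p e X N) (x : X) :
    hom p e (a • f) x = FrobeniusPushforward.of p e N
      (a • (FrobeniusPushforward.of p e N).symm (hom p e f x)) := rfl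

instance {A : Type*} [CommRing A] [Algebra R A] [Module A N] [IsScalarTower R A N] :
    IsScalarTower R A (HomPushforward R p e X N) where
  smul_assoc r a f := by
    refine (hom p e).injective (LinearMap.ext fun x => ?_)
    rw [hom_smul_apply, hom_smul_apply, hom_smul_apply, smul_assoc]
    rfl

/-- `F^e_*` of this module is `Hom_R(X, F^e_* N)`. -/
def pushforwardEquiv : FrobeniusPushforward p e (HomPushforward R p e X N) ≃ₗ[R]
    (X →ₗ[R] FrobeniusPushforward p e N) where
  toFun f := hom p e ((FrobeniusPushforward.of p e _).symm f)
  invFun f := FrobeniusPushforward.of p e _ ((hom p e).symm f)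
  left_inv _ := rfl
  right_inv _ := rfl
  map_add' _ _ := rfl
  map_smul' _ _ := rfl

end HomPushforward

section Core

open FrobeniusPushforward

variable {R S : Type u} [CommRing R] [IsLocalRing R] [IsNoetherianRing R]
  {p : ℕ} [Fact p.Prime] [CharP R p] [CommRing S] [Algebra R S] [ExpChar S p]
  {M : Type u} [AddCommGroup M] [Module R M] [Module S M] [IsScalarTower R S M]

theorem IsCMModule.frobeniusPushforward (hF : Module.Finite R (FrobeniusPushforward p 1 R))
    (e : ℕ) {N : Type u} [AddCommGroup N] [Module R N] (hN : IsCMModule R N) :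
    IsCMModule R (FrobeniusPushforward p e N) := by
  obtain ⟨n, hn⟩ := exists_natCast_eq_ringKrullDim R
  rw [isCMModule_iff hn] at hN ⊢
  have := hN.1
  exact ⟨finite p e hF, hasDepthGE p e hN.2⟩

theorem IsCMModule.of_frobeniusPushforward (e : ℕ) {N : Type u} [AddCommGroup N] [Module R N]
    (hN : IsCMModule R (FrobeniusPushforward p e N)) : IsCMModule R N := by
  obtain ⟨n, hn⟩ := exists_natCast_eq_ringKrullDim R
  rw [isCMModule_iff hn] at hN ⊢
  have := hN.1
  exact ⟨finite_of_finite p e, hasDepthGE_of_pushforward p e hN.2⟩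

/-- `F^e_* S` is a Cohen-Macaulay `S`-module, hence a summand of a power of the generator, and
`F^e_* R` is a summand of `F^e_* S`. -/
theorem IsCMGenerator.inAdd_frobeniusPushforward (hM : IsCMGenerator R S M)
    (hF : Module.Finite R (FrobeniusPushforward p 1 R)) (hS : IsCMModule R S)
    (hpure : IsPureExtension R S) (e : ℕ) :
    InAdd R M (FrobeniusPushforward p e S) ∧ InAdd R M (FrobeniusPushforward p e R) := by
  have h1 : InAdd R M (FrobeniusPushforward p e S) :=
    (hM.2 (FrobeniusPushforward p e S) (hS.frobeniusPushforward hF e)).restrictScalars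
  obtain ⟨π, hπ⟩ := hpure
  refine ⟨h1, InAdd.trans (InAdd.of_retract (map p e (Algebra.linearMap R S)) (map p e π) ?_) h1⟩
  exact fun x => LinearMap.congr_fun hπ x

/-- The generator is a summand of a power of `F^e_* R` for all large `e`. A fixed multiplication by
`c ≠ 0` on all Cohen-Macaulay `S`-modules factors through free `R`-modules. The module
`Hom_R(M*, F^e_* S)` is `F^e_*` of such a module, so on it multiplication by `c ^ (1 / q)` factors
through a power of `F^e_* R`. On the other hand, `M = M** = Hom_R(M*, R)` embeds into
`Hom_R(M*, F^e_* S)` in such a way that a splitting of `1 ↦ c ^ (1 / q)` maps `c ^ (1 / q) M` back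
onto `M`. -/
theorem IsCMGenerator.exists_forall_inAdd [IsDomain R] (hM : IsCMGenerator R S M)
    (hF : Module.Finite R (FrobeniusPushforward p 1 R)) (hS : IsCMModule R S)
    (hpure : IsPureExtension R S) (hEnd : IsCMModule R (Module.End R M))
    (hreg : IsStronglyFRegular R p) (hR : InAdd R M R) [Module.IsReflexive R M] :
    ∃ e₀ : ℕ, ∀ e, e₀ ≤ e → InAdd R (FrobeniusPushforward p e R) M := by
  have hnorm := hreg.isIntegrallyClosed
  obtain ⟨n, hn⟩ := exists_natCast_eq_ringKrullDim R
  have hMfin := hM.1.1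
  have htf : Module.IsTorsionFree R M := ((isCMModule_iff hn).1 hM.1).2.isTorsionFree hn
  obtain ⟨c, hc0, hc⟩ := exists_factorsThroughFree_of_forall_eq (N := M) (⊥ : Ideal R)
    fun Q _ h1 h2 => absurd (le_bot_iff.1 h2) h1
  rw [Submodule.mem_bot] at hc0
  obtain ⟨e₀, he₀⟩ := hreg.exists_forall_splitting hc0
  refine ⟨e₀, fun e he => ?_⟩
  obtain ⟨φ, hφ⟩ := he₀ e he
  obtain ⟨h1, -⟩ := hM.inAdd_frobeniusPushforward hF hS hpure e
  obtain ⟨π, hπ⟩ := hpure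
  let D := Module.Dual R M
  have hY : IsCMModule R (D →ₗ[R] FrobeniusPushforward p e S) :=
    hEnd.of_inAdd (InAdd.hom (hM.inAdd_dual hR hEnd) h1)
  have hY' : IsCMModule R (HomPushforward R p e D S) := .of_frobeniusPushforward (p := p) e <|
    hY.of_inAdd (InAdd.of_linearEquiv (HomPushforward.pushforwardEquiv R p e D S))
  obtain ⟨m, f, y, hfy⟩ := hc.of_inAdd (hM.2 _ hY').restrictScalars
  let E := HomPushforward.pushforwardEquiv R p e D S
  let ι : R →ₗ[R] FrobeniusPushforward p e S := LinearMap.toSpanSingleton R _ (of p e S 1)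
  let β : FrobeniusPushforward p e S →ₗ[R] R := φ ∘ₗ map p e π
  refine InAdd.trans (InAdd.of_linearEquiv (Module.evalEquiv R M)) <|
    InAdd.of_sum_eq_id
      (fun j => map p e (f j) ∘ₗ E.symm.toLinearMap ∘ₗ LinearMap.compRight R ι)
      (fun j => LinearMap.compRight R β ∘ₗ E.toLinearMap ∘ₗ
        map p e (LinearMap.toSpanSingleton R (HomPushforward R p e D S) (y j))) fun θ => ?_
  let ψ : HomPushforward R p e D S := (HomPushforward.hom p e).symm (ι ∘ₗ θ)
  have hsum : ∀ j, (LinearMap.compRight R β ∘ₗ E.toLinearMap ∘ₗ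
      map p e (LinearMap.toSpanSingleton R (HomPushforward R p e D S) (y j)))
      ((map p e (f j) ∘ₗ E.symm.toLinearMap ∘ₗ LinearMap.compRight R ι) θ) =
      (LinearMap.compRight R β ∘ₗ E.toLinearMap) (of p e _ (f j ψ • y j)) := fun j => rfl
  rw [Finset.sum_congr rfl fun j _ => hsum j, ← map_sum, ← map_sum, hfy]
  ext l
  change φ (of p e R (π (c • (θ l) ^ p ^ e • (1 : S)))) = θ l
  have hπ1 : π (1 : S) = 1 := by simpa using LinearMap.congr_fun hπ 1
  have hπc : π (c • (θ l) ^ p ^ e • (1 : S)) = (θ l) ^ p ^ e • c := by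
    rw [map_smul, map_smul, hπ1, smul_eq_mul, smul_eq_mul, mul_one, mul_comm, smul_eq_mul]
  rw [hπc, ← smul_of, map_smul, hφ, smul_eq_mul, mul_one]

end Core

/-! ### Morita equivalence of endomorphism rings -/

section Morita

open scoped ModuleCat.Algebra

variable (R : Type u) [CommRing R]

/-- The `End(M)`-linear maps from `Hom_R(N, M)` to an `End(M)`-module `X`. They form an
`End(N)`-module, with `b` acting by precomposition `h ↦ h ∘ b` on `Hom_R(N, M)`. -/
def EndHom (M N : Type u) [AddCommGroup M] [Module R M] [AddCommGroup N] [Module R N] (X : Type u)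
    [AddCommGroup X] [Module (Module.End R M) X] : Type u :=
  (N →ₗ[R] M) →ₗ[Module.End R M] X

namespace EndHom

variable {R} {M N : Type u} [AddCommGroup M] [Module R M] [AddCommGroup N] [Module R N]
  {X Y : Type u} [AddCommGroup X] [Module (Module.End R M) X] [AddCommGroup Y]
  [Module (Module.End R M) Y]

instance : AddCommGroup (EndHom R M N X) :=
  inferInstanceAs (AddCommGroup ((N →ₗ[R] M) →ₗ[Module.End R M] X))

instance : FunLike (EndHom R M N X) (N →ₗ[R] M) X :=
  inferInstanceAs (FunLike ((N →ₗ[R] M) →ₗ[Module.End R M] X) _ _)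

instance : LinearMapClass (EndHom R M N X) (Module.End R M) (N →ₗ[R] M) X :=
  inferInstanceAs (LinearMapClass ((N →ₗ[R] M) →ₗ[Module.End R M] X) (Module.End R M) _ _)

@[ext]
theorem ext {f g : EndHom R M N X} (h : ∀ q, f q = g q) : f = g := DFunLike.ext _ _ h

@[simp]
theorem add_apply (f g : EndHom R M N X) (q : N →ₗ[R] M) : (f + g) q = f q + g q := rfl

instance : Module (Module.End R N) (EndHom R M N X) where
  smul b f := LinearMap.comp (σ₁₂ := RingHom.id _) (σ₁₃ := RingHom.id _) f
    { toFun := fun q => q ∘ₗ b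
      map_add' := fun _ _ => LinearMap.add_comp _ _ _
      map_smul' := fun _ _ => rfl }
  one_smul f := rfl
  mul_smul a b f := rfl
  smul_zero a := rfl
  smul_add a f g := rfl
  add_smul a b f := by
    ext q
    change f (q ∘ₗ (a + b)) = f (q ∘ₗ a) + f (q ∘ₗ b)
    rw [LinearMap.comp_add, map_add]
  zero_smul f := by
    ext q
    change f (q ∘ₗ 0) = 0
    rw [LinearMap.comp_zero, map_zero]

@[simp]
theorem smul_apply (b : Module.End R N) (f : EndHom R M N X) (q : N →ₗ[R] M) :
    (b • f) q = f (q ∘ₗ b) := rfl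

/-- The functoriality of `EndHom` in the module. -/
def map (g : X →ₗ[Module.End R M] Y) : EndHom R M N X →ₗ[Module.End R N] EndHom R M N Y where
  toFun f := LinearMap.comp (σ₁₂ := RingHom.id _) (σ₁₃ := RingHom.id _) g f
  map_add' f f' := by
    ext q
    exact map_add g (f q) (f' q)
  map_smul' b f := rfl

/-- The evaluation `X → Hom(Hom(M, N), Hom(Hom(N, M), X))`, `x ↦ (q ↦ (p ↦ (p ∘ q) x))`. -/
def unit : X →ₗ[Module.End R M] EndHom R N M (EndHom R M N X) where
  toFun x :=
    { toFun := fun q =>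
        { toFun := fun p => (p ∘ₗ q : Module.End R M) • x
          map_add' := fun p p' => by rw [LinearMap.add_comp, add_smul]
          map_smul' := fun a p => mul_smul a (p ∘ₗ q : Module.End R M) x }
      map_add' := fun q q' => by
        ext p
        change (p ∘ₗ (q + q') : Module.End R M) • x = (p ∘ₗ q : Module.End R M) • x + _
        rw [LinearMap.comp_add, add_smul]
        rfl
      map_smul' := fun b q => rfl }
  map_add' x y := by
    ext q p
    exact smul_add (p ∘ₗ q : Module.End R M) x y
  map_smul' a x := by
    ext q p
    exact (mul_smul (p ∘ₗ q : Module.End R M) a x).symm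

@[simp]
theorem unit_apply (x : X) (q : M →ₗ[R] N) (p : N →ₗ[R] M) :
    (unit x q : EndHom R M N X) p = (p ∘ₗ q : Module.End R M) • x := rfl

/-- If the identity of `M` is `∑ pᵢ qᵢ` with `pᵢ : N → M` and `qᵢ : M → N`, the evaluation map is
bijective, its inverse being `F ↦ ∑ F(qᵢ)(pᵢ)`. -/
theorem unit_bijective (h : InAdd R N M) :
    Function.Bijective (unit : X →ₗ[Module.End R M] EndHom R N M (EndHom R M N X)) := by
  obtain ⟨l, i, π, h⟩ := h.exists_sum_eq_id
  have hid : ∑ k, (π k ∘ₗ i k : Module.End R M) = 1 := by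
    ext x
    simp [LinearMap.sum_apply, h]
  constructor
  · refine (injective_iff_map_eq_zero _).2 fun x hx => ?_
    rw [← one_smul (Module.End R M) x, ← hid, Finset.sum_smul]
    refine Finset.sum_eq_zero fun k _ => ?_
    rw [← unit_apply, hx]
    rfl
  · intro F
    refine ⟨∑ k, F (i k) (π k), ?_⟩
    ext q p
    rw [unit_apply, Finset.smul_sum]
    have key : ∀ k, (p ∘ₗ q : Module.End R M) • F (i k) (π k) =
        F (q ∘ₗ (π k ∘ₗ i k)) p := fun k => by
      have h1 : (q ∘ₗ (π k ∘ₗ i k)) = (q ∘ₗ π k : Module.End R N) • i k := rfl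
      rw [h1, map_smul, smul_apply, ← map_smul]
      rfl
    have hsum : q = ∑ k, q ∘ₗ (π k ∘ₗ i k) := by
      ext x
      simp [LinearMap.sum_apply, ← map_sum, h]
    rw [Finset.sum_congr rfl fun k _ => key k]
    conv_rhs => rw [hsum, map_sum]
    have happ : ∀ (s : Finset (Fin l)) (G : Fin l → EndHom R M N X),
        (∑ k ∈ s, G k) p = ∑ k ∈ s, G k p := fun s G => by
      induction s using Finset.cons_induction with
      | empty => rfl
      | cons a s ha ih => rw [Finset.sum_cons, Finset.sum_cons, add_apply, ih]
    rw [happ]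

variable (R M N) in
/-- The functor `X ↦ Hom(Hom_R(N, M), X)` from `End(M)`-modules to `End(N)`-modules. -/
def functor : ModuleCat.{u} (Module.End R M) ⥤ ModuleCat.{u} (Module.End R N) where
  obj X := ModuleCat.of _ (EndHom R M N X)
  map g := ModuleCat.ofHom (map g.hom)

variable (R M N) in
/-- The natural isomorphism given by `EndHom.unit`. -/
noncomputable def unitIso (h : InAdd R N M) :
    𝟭 (ModuleCat.{u} (Module.End R M)) ≅ functor R M N ⋙ functor R N M :=
  NatIso.ofComponents
    (fun X => (LinearEquiv.ofBijective (unit (R := R) (M := M) (N := N) (X := X))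
      (unit_bijective h)).toModuleIso) <| by
    intro X Y g
    ext x
    refine EndHom.ext fun q => EndHom.ext fun p => ?_
    exact (map_smul g.hom (p ∘ₗ q : Module.End R M) x).symm

instance (M N : Type u) [AddCommGroup M] [Module R M] [AddCommGroup N] [Module R N] :
    (functor R M N).Linear R where
  map_smul {X Y} g r := by
    ext f
    refine EndHom.ext fun q => ?_
    have hq : q ∘ₗ algebraMap R (Module.End R N) r = algebraMap R (Module.End R M) r • q := by
      ext x
      simp
    have hf : ∀ f : EndHom R M N X, algebraMap R (Module.End R M) r • g.hom (f q) =
        g.hom (f (q ∘ₗ algebraMap R (Module.End R N) r)) := fun f => by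
      rw [hq, map_smul f, map_smul g.hom]
    exact hf f

end EndHom

/-- If `add M = add N`, then `End(M)` and `End(N)` are Morita equivalent. -/
theorem isMoritaEquivalent_end (M N : Type u) [AddCommGroup M] [Module R M] [AddCommGroup N]
    [Module R N] (h : InAdd R N M) (h' : InAdd R M N) :
    IsMoritaEquivalent R (Module.End R M) (Module.End R N) where
  cond := ⟨{
    eqv := CategoryTheory.Equivalence.mk (EndHom.functor R M N) (EndHom.functor R N M)
      (EndHom.unitIso R M N h) (EndHom.unitIso R N M h').symm
    linear := inferInstanceAs ((EndHom.functor R M N).Linear R) }⟩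

end Morita

/-! ### Projective and global dimension -/

/-- An equivalence of abelian categories preserves projective dimension. -/
theorem CategoryTheory.Equivalence.hasProjectiveDimensionLT.{v} {C D : Type*} [Category.{v} C]
    [Category.{v} D] [Abelian C] [Abelian D] [EnoughProjectives C] (E : C ≌ D) (n : ℕ) (X : C)
    (h : HasProjectiveDimensionLT X n) : HasProjectiveDimensionLT (E.functor.obj X) n := by
  match n with
  | 0 =>
    rw [hasProjectiveDimensionLT_zero_iff_isZero] at h ⊢
    exact E.functor.map_isZero h
  | n + 1 =>
    induction n generalizing X with
    | zero =>
      rw [zero_add, ← projective_iff_hasProjectiveDimensionLT_one] at h ⊢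
      exact E.map_projective_iff X |>.2 h
    | succ n ih =>
      let ⟨p⟩ := EnoughProjectives.presentation X
      have hS : (ShortComplex.mk _ _ (Limits.kernel.condition p.f)).ShortExact :=
        { exact := ShortComplex.exact_kernel p.f }
      have h1 := (hS.hasProjectiveDimensionLT_X₃_iff n p.projective).1 h
      have hS' := hS.map_of_exact E.functor
      exact (hS'.hasProjectiveDimensionLT_X₃_iff n ((E.map_projective_iff _).2 p.projective)).2
        (ih _ h1)

section GlobalDimension

open Abelian

variable {A : Type u} [Ring A]

/-- Baer's criterion for injective dimension: it is detected by `Ext` from cyclic modules. -/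
theorem hasInjectiveDimensionLT_of_cyclic (n : ℕ) (Y : ModuleCat.{u} A)
    (h : ∀ I : Ideal A, Subsingleton (Ext (ModuleCat.of A (A ⧸ I)) Y (n + 1))) :
    HasInjectiveDimensionLT Y (n + 1) := by
  induction n generalizing Y with
  | zero =>
    rw [zero_add, ← injective_iff_hasInjectiveDimensionLT_one,
      ← Module.injective_iff_injective_object A Y]
    refine Module.Baer.injective fun I g => ?_
    let S : ShortComplex (ModuleCat.{u} A) :=
      ModuleCat.shortComplexOfCompEqZero I.subtype I.mkQ (by ext; simp)
    have hS : S.ShortExact := ModuleCat.shortComplex_shortExact S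
      (LinearMap.exact_subtype_mkQ I) I.injective_subtype I.mkQ_surjective
    obtain ⟨x₂, hx₂⟩ := Ext.contravariant_sequence_exact₁ hS Y (Ext.mk₀ (ModuleCat.ofHom g))
      (zero_add 1) ((h I).elim _ _)
    obtain ⟨f, rfl⟩ := (Ext.mk₀_bijective S.X₂ Y).2 x₂
    rw [Ext.mk₀_comp_mk₀, (Ext.mk₀_bijective _ _).1.eq_iff] at hx₂
    refine ⟨f.hom, fun x hx => ?_⟩
    exact LinearMap.congr_fun (congrArg ModuleCat.Hom.hom hx₂) ⟨x, hx⟩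
  | succ n ih =>
    let ⟨p⟩ := EnoughInjectives.presentation Y
    have hS : (ShortComplex.mk _ _ (Limits.cokernel.condition p.f)).ShortExact :=
      { exact := ShortComplex.exact_cokernel p.f }
    rw [← hS.hasInjectiveDimensionLT_X₃_iff n p.injective]
    refine ih _ fun I => ⟨fun x y => ?_⟩
    rw [← sub_eq_zero]
    obtain ⟨z, hz⟩ := Ext.covariant_sequence_exact₃ (ModuleCat.of A (A ⧸ I)) hS (x - y)
      (n₁ := n + 2) (by omega) ((h I).elim _ _)
    have := p.injective
    have hz0 : z = 0 := Ext.eq_zero_of_injective _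
    rw [← hz, hz0, Ext.zero_comp]

/-- The global dimension is the supremum of the projective dimensions of the cyclic modules. -/
theorem hasProjectiveDimensionLT_of_cyclic (n : ℕ)
    (h : ∀ I : Ideal A, HasProjectiveDimensionLT (ModuleCat.of A (A ⧸ I)) (n + 1))
    (X : ModuleCat.{u} A) : HasProjectiveDimensionLT X (n + 1) := by
  rw [hasProjectiveDimensionLT_iff]
  intro i hi Y x
  have hY : HasInjectiveDimensionLT Y (n + 1) := hasInjectiveDimensionLT_of_cyclic n Y fun I =>
    HasProjectiveDimensionLT.subsingleton _ (n + 1) _ le_rfl Y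
  exact (HasInjectiveDimensionLT.subsingleton Y (n + 1) i hi X).elim _ _

/-- The projective dimension of a quotient of a projective module is at most one more than that of
the kernel. -/
theorem hasProjectiveDimensionLT_of_surjective {F X : Type u} [AddCommGroup F] [Module A F]
    [AddCommGroup X] [Module A X] [Module.Projective A F] (f : F →ₗ[A] X)
    (hf : Function.Surjective f) {n : ℕ}
    (h : HasProjectiveDimensionLT (ModuleCat.of A (LinearMap.ker f)) n) :
    HasProjectiveDimensionLT (ModuleCat.of A X) (n + 1) := by
  have hS := LinearMap.shortExact_shortComplexKer hf
  have hF : Projective (ModuleCat.of A F) := (IsProjective.iff_projective F).1 inferInstance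
  exact hS.hasProjectiveDimensionLT_X₃ n h inferInstance

end GlobalDimension

/-- The property of having finite global dimension is invariant under Morita equivalence. -/
theorem HasFiniteGlobalDimension.of_isMoritaEquivalent {R : Type u} [CommRing R] {A B : Type u}
    [Ring A] [Algebra R A] [Ring B] [Algebra R B] (h : IsMoritaEquivalent R A B)
    (hA : HasFiniteGlobalDimension A) : HasFiniteGlobalDimension B := by
  obtain ⟨⟨E⟩⟩ := h
  obtain ⟨n, hn⟩ := hA
  refine ⟨n, fun X => ?_⟩
  have h1 : HasProjectiveDimensionLT ((E.eqv.inverse ⋙ E.eqv.functor).obj X) (n + 1) :=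
    E.eqv.hasProjectiveDimensionLT (n + 1) _ (hn (E.eqv.inverse.obj X))
  exact hasProjectiveDimensionLT_of_iso (E.eqv.counitIso.app X) (n + 1)

/-! ### The global dimension of the endomorphism ring of a generator -/

/-- Passing to a syzygy raises the depth: if `rs` is weakly regular on `F`, and its first `j`
members are so on the quotient `X` of `F`, then its first `j + 1` members are weakly regular on the
kernel. -/
theorem RingTheory.Sequence.IsWeaklyRegular.ker_of_surjective {R : Type*} [CommRing R]
    {K F X : Type*} [AddCommGroup K] [Module R K] [AddCommGroup F] [Module R F] [AddCommGroup X]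
    [Module R X] {f : K →ₗ[R] F} {g : F →ₗ[R] X} (hf : Function.Injective f)
    (hfg : Function.Exact f g) (hg : Function.Surjective g) (rs : List R) (j : ℕ)
    (hF : IsWeaklyRegular F rs) (hX : IsWeaklyRegular X (rs.take j)) :
    IsWeaklyRegular K (rs.take (j + 1)) := by
  induction rs generalizing K F X j with
  | nil => exact IsWeaklyRegular.nil R K
  | cons r rs ih =>
    rw [List.take_succ_cons, isWeaklyRegular_cons_iff]
    rw [isWeaklyRegular_cons_iff] at hF
    have hK : IsSMulRegular K r := hF.1.of_injective f hf
    refine ⟨hK, ?_⟩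
    match j with
    | 0 => exact IsWeaklyRegular.nil R _
    | j + 1 =>
      rw [List.take_succ_cons, isWeaklyRegular_cons_iff] at hX
      refine ih (f := QuotSMulTop.map r f) (g := QuotSMulTop.map r g) ?_
        (QuotSMulTop.map_exact r hfg hg) (QuotSMulTop.map_surjective r hg) j hF.2 hX.2
      rw [← LinearMap.ker_eq_bot]
      refine LinearMap.ker_eq_bot'.2 fun x hx => ?_
      obtain ⟨x, rfl⟩ := Submodule.mkQ_surjective (r • (⊤ : Submodule R K)) x
      have hx' : f x ∈ r • (⊤ : Submodule R F) := by
        rw [← Submodule.Quotient.mk_eq_zero]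
        exact hx
      obtain ⟨y, -, hy⟩ := (Submodule.mem_smul_pointwise_iff_exists _ _ _).1 hx'
      have hgy : g y = 0 := hX.1.right_eq_zero_of_smul (by
        rw [← map_smul, hy]
        exact hfg.apply_apply_eq_zero x)
      obtain ⟨z, rfl⟩ := (hfg y).1 hgy
      rw [← map_smul] at hy
      rw [← hf hy, Submodule.mkQ_apply, Submodule.Quotient.mk_eq_zero]
      exact Submodule.smul_mem_pointwise_smul z r ⊤ trivial

section HomProjective

variable {R : Type*} [CommRing R] {M N : Type*} [AddCommGroup M] [Module R M] [AddCommGroup N]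
  [Module R N]

theorem eq_of_forall_dual_comp_eq [Module.IsReflexive R M] {f g : N →ₗ[R] M}
    (h : ∀ l : Module.Dual R M, l ∘ₗ f = l ∘ₗ g) : f = g := by
  ext x
  refine (Module.bijective_dual_eval R M).1 (LinearMap.ext fun l => ?_)
  exact LinearMap.congr_fun (h l) x

/-- If `M` is reflexive and the dual of `N` is a summand of a power of the dual of `M`, then
`Hom_R(N, M) = Hom_R(M*, N*)` is a projective `End_R(M)`-module. -/
theorem projective_hom_of_inAdd_dual [Module.IsReflexive R M]
    (h : InAdd R (Module.Dual R M) (Module.Dual R N)) :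
    Module.Projective (Module.End R M) (N →ₗ[R] M) := by
  obtain ⟨l, i, π, h⟩ := h.exists_sum_eq_id
  let e := Module.evalEquiv R M
  have he : ∀ (x : M) (w : Module.Dual R M), e x w = w x := fun x w => rfl
  have he' : ∀ (θ : Module.Dual R (Module.Dual R M)) (w : Module.Dual R M),
      w (e.symm θ) = θ w := fun θ w => by rw [← he, LinearEquiv.apply_symm_apply]
  -- `α k f` is the endomorphism of `M` dual to `w ↦ i k (w ∘ f)`
  let α : Fin l → (N →ₗ[R] M) →ₗ[Module.End R M] Module.End R M := fun k =>
    { toFun := fun f => e.symm.toLinearMap ∘ₗ (i k ∘ₗ f.dualMap).dualMap ∘ₗ e.toLinearMap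
      map_add' := fun f g => by
        refine eq_of_forall_dual_comp_eq fun w => ?_
        ext x
        simp [he', he, LinearMap.dualMap_apply', LinearMap.comp_add]
      map_smul' := fun a f => by
        refine eq_of_forall_dual_comp_eq fun w => ?_
        ext x
        have h1 : w (a (e.symm ((i k ∘ₗ f.dualMap).dualMap (e x)))) =
            (w ∘ₗ a) (e.symm ((i k ∘ₗ f.dualMap).dualMap (e x))) := rfl
        simp only [LinearMap.comp_apply, LinearEquiv.coe_coe, RingHom.id_apply,
          LinearMap.smul_apply, Module.End.smul_def, he', h1]
        rfl }
  have hα : ∀ k f (w : Module.Dual R M), w ∘ₗ (α k f) = i k (w ∘ₗ f) := fun k f w => by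
    ext x
    exact he' _ w
  let ρ : Fin l → N →ₗ[R] M := fun k =>
    e.symm.toLinearMap ∘ₗ (π k).dualMap ∘ₗ Module.Dual.eval R N
  have hρ : ∀ k (w : Module.Dual R M), w ∘ₗ ρ k = π k w := fun k w => by
    ext x
    exact he' _ w
  have hadd : InAdd (Module.End R M) (Module.End R M) (N →ₗ[R] M) := by
    refine InAdd.of_sum_eq_id α (fun k => LinearMap.toSpanSingleton _ _ (ρ k)) fun f => ?_
    refine eq_of_forall_dual_comp_eq fun w => ?_
    have h2 : ∀ k, w ∘ₗ (α k f ∘ₗ ρ k) = π k (i k (w ∘ₗ f)) := fun k => by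
      rw [← LinearMap.comp_assoc, hα, hρ]
    have h3 : ∀ k, LinearMap.toSpanSingleton (Module.End R M) _ (ρ k) (α k f) = α k f ∘ₗ ρ k :=
      fun k => rfl
    rw [Finset.sum_congr rfl fun k _ => h3 k]
    have h4 : w ∘ₗ (∑ k, α k f ∘ₗ ρ k) = ∑ k, w ∘ₗ (α k f ∘ₗ ρ k) := by
      ext x
      simp [LinearMap.sum_apply]
    rw [h4, Finset.sum_congr rfl fun k _ => h2 k, h]
  obtain ⟨m, s, t, hst⟩ := hadd
  exact Module.Projective.of_split s t hst

end HomProjective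

section KerEnd

variable {R : Type u} [CommRing R] {M : Type u} [AddCommGroup M] [Module R M]

/-- The kernel of an `End_R(M)`-linear map between free modules is `Hom_R(N, M)`, with `N` the
cokernel of the transposed map between powers of `M`. -/
theorem exists_linearEquiv_ker {a b : ℕ}
    (h : (Fin a → Module.End R M) →ₗ[Module.End R M] (Fin b → Module.End R M)) :
    ∃ (N : Type u) (_ : AddCommGroup N) (_ : Module R N),
      Nonempty ((N →ₗ[R] M) ≃ₗ[Module.End R M] LinearMap.ker h) := by
  let c : Fin a → Fin b → Module.End R M := fun i j => h (Pi.single i 1) j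
  have hc : ∀ f j, h f j = ∑ i, f i * c i j := fun f j => by
    have h1 : f = ∑ i, f i • (Pi.single i (1 : Module.End R M) : Fin a → Module.End R M) := by
      conv_lhs => rw [← Finset.univ_sum_single f]
      exact Finset.sum_congr rfl fun i _ => by rw [← Pi.single_smul, smul_eq_mul, mul_one]
    conv_lhs => rw [h1, map_sum, Finset.sum_apply]
    exact Finset.sum_congr rfl fun i _ => by rw [map_smul]; rfl
  let η : (Fin b → M) →ₗ[R] (Fin a → M) :=
    LinearMap.pi fun i => ∑ j, c i j ∘ₗ LinearMap.proj j
  let N := (Fin a → M) ⧸ LinearMap.range η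
  let T : (N →ₗ[R] M) →ₗ[Module.End R M] (Fin a → Module.End R M) :=
    { toFun := fun g i => g ∘ₗ Submodule.mkQ _ ∘ₗ LinearMap.single R (fun _ => M) i
      map_add' := fun _ _ => rfl
      map_smul' := fun _ _ => rfl }
  have hsum : ∀ m : Fin a → M, ∑ i, LinearMap.single R (fun _ => M) i (m i) = m := fun m => by
    simpa using Finset.univ_sum_single m
  have hT : Function.Injective T := fun g g' hgg => by
    ext i x
    exact LinearMap.congr_fun (congrFun hgg i) x
  have hrange : LinearMap.range T = LinearMap.ker h := by
    ext f
    rw [LinearMap.mem_range, LinearMap.mem_ker]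
    constructor
    · rintro ⟨g, rfl⟩
      funext j
      rw [hc]
      ext x
      have h2 : η (Pi.single j x) ∈ LinearMap.range η := ⟨_, rfl⟩
      rw [← Submodule.Quotient.mk_eq_zero, ← Submodule.mkQ_apply] at h2
      have h3 : ∀ i, η (Pi.single j x) i = c i j x := fun i => by
        simp only [η, LinearMap.pi_apply, LinearMap.sum_apply, LinearMap.comp_apply,
          LinearMap.proj_apply]
        rw [Finset.sum_eq_single j]
        · rw [Pi.single_eq_same]
        · intro k _ hk
          rw [Pi.single_eq_of_ne hk, map_zero]
        · simp
      have h4 : g (Submodule.mkQ (LinearMap.range η) (η (Pi.single j x))) = 0 := by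
        rw [h2, map_zero]
      rw [← hsum (η (Pi.single j x)), map_sum, map_sum] at h4
      rw [LinearMap.sum_apply]
      refine Eq.trans (Finset.sum_congr rfl fun i _ => ?_) h4
      rw [h3]
      rfl
    · intro hf
      let φ : (Fin a → M) →ₗ[R] M := ∑ i, f i ∘ₗ LinearMap.proj i
      have hφ : ∀ m, φ m = ∑ i, f i (m i) := fun m => by simp [φ, LinearMap.sum_apply]
      have hle : LinearMap.range η ≤ LinearMap.ker φ := by
        rintro _ ⟨m, rfl⟩
        rw [LinearMap.mem_ker, hφ]
        simp only [η, LinearMap.pi_apply, LinearMap.sum_apply, LinearMap.comp_apply,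
          LinearMap.proj_apply, map_sum]
        rw [Finset.sum_comm]
        refine Finset.sum_eq_zero fun j _ => ?_
        have h5 := LinearMap.congr_fun ((hc f j).symm.trans (congrFun hf j)) (m j)
        rw [LinearMap.sum_apply] at h5
        exact h5
      refine ⟨(LinearMap.range η).liftQ φ hle, ?_⟩
      funext i
      ext x
      change φ (LinearMap.single R (fun _ => M) i x) = f i x
      rw [hφ, Finset.sum_eq_single i]
      · simp
      · intro k _ hk
        simp [Pi.single_eq_of_ne hk]
      · simp
  exact ⟨N, inferInstance, inferInstance,
    ⟨(LinearEquiv.ofInjective T hT).trans (LinearEquiv.ofEq _ _ hrange)⟩⟩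

end KerEnd

section GlobalDimensionEnd

variable {R S : Type u} [CommRing R] [IsLocalRing R] [CommRing S] [Algebra R S]
  {M : Type u} [AddCommGroup M] [Module R M] [Module S M] [IsScalarTower R S M]

/-- A second syzygy over `End_R(M)` that is Cohen-Macaulay over `R` is projective. As `S` maps to
`End_R(M)`, the syzygy `Hom_R(N, M)` lies in `add M` over `R`, hence so does the dual of `N`. -/
theorem IsCMGenerator.projective_ker (hM : IsCMGenerator R S M) (hR : InAdd R M R)
    (hEnd : IsCMModule R (Module.End R M)) [Module.IsReflexive R M] {a b : ℕ}
    (h : (Fin a → Module.End R M) →ₗ[Module.End R M] (Fin b → Module.End R M))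
    (hK : IsCMModule R (LinearMap.ker h)) :
    Module.Projective (Module.End R M) (LinearMap.ker h) := by
  obtain ⟨N, _, _, ⟨e⟩⟩ := exists_linearEquiv_ker h
  have h1 : InAdd R M (LinearMap.ker h) := hM.inAdd_of_algHom hK <|
    (Algebra.lsmul R R (LinearMap.ker h) : Module.End R M →ₐ[R] _).comp
      (Algebra.lsmul R R M : S →ₐ[R] _)
  have h2 : InAdd R M (N →ₗ[R] M) := InAdd.trans (InAdd.of_linearEquiv (e.restrictScalars R)) h1
  have h3 : InAdd R M (Module.Dual R N) := InAdd.trans (InAdd.hom_right N hR) h2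
  have h4 : InAdd R (Module.Dual R M) M :=
    InAdd.trans (InAdd.of_linearEquiv (Module.evalEquiv R M)) ((hM.inAdd_dual hR hEnd).hom_left R)
  have := projective_hom_of_inAdd_dual (h3.trans h4)
  exact Module.Projective.of_equiv e

/-- If `M` is a reflexive generator and `End_R(M)` is Cohen-Macaulay, then `End_R(M)` has finite
global dimension: passing to a syzygy raises the depth over `R`, and a second syzygy of maximal
depth is projective. -/
theorem IsCMGenerator.hasFiniteGlobalDimension_end [IsNoetherianRing R]
    (hM : IsCMGenerator R S M) (hR : InAdd R M R) (hEnd : IsCMModule R (Module.End R M))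
    [Module.IsReflexive R M] : HasFiniteGlobalDimension (Module.End R M) := by
  obtain ⟨_, rs, hrs₁, hrs₂, hrs⟩ := id hEnd
  let A := Module.End R M
  have hfree : ∀ a : ℕ, IsWeaklyRegular (Fin a → A) rs := fun a => hrs.of_inAdd (InAdd.pi a)
  have hnoeth : ∀ a : ℕ, IsNoetherian A (Fin a → A) := fun a =>
    isNoetherian_of_tower R inferInstance
  have hker : ∀ {a : ℕ} {X : Type u} [AddCommGroup X] [Module R X] [Module A X]
      [IsScalarTower R A X] (f : (Fin a → A) →ₗ[A] X), Function.Surjective f → ∀ j : ℕ,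
      IsWeaklyRegular X (rs.take j) → IsWeaklyRegular (LinearMap.ker f) (rs.take (j + 1)) := by
    intro a X _ _ _ _ f hf j hX
    exact IsWeaklyRegular.ker_of_surjective
      (f := (LinearMap.ker f).subtype.restrictScalars R) (g := f.restrictScalars R)
      (LinearMap.ker f).injective_subtype (LinearMap.exact_subtype_ker_map f) hf rs j (hfree a) hX
  have main : ∀ (t j : ℕ) (X : Type u) [AddCommGroup X] [Module R X] [Module A X]
      [IsScalarTower R A X] [Module.Finite A X], rs.length ≤ j + t →
      IsWeaklyRegular X (rs.take j) →
      HasProjectiveDimensionLT (ModuleCat.of A X) (t + 3) := by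
    intro t
    induction t with
    | zero =>
      intro j X _ _ _ _ _ hj hX
      obtain ⟨a, f, hf⟩ := Module.Finite.exists_fin' A X
      have h1 := hker f hf j hX
      obtain ⟨b, g, hg⟩ := Module.Finite.exists_fin' A (LinearMap.ker f)
      have h2 := hker g hg (j + 1) h1
      rw [List.take_of_length_le (by omega)] at h2
      have hcomp : LinearMap.ker ((LinearMap.ker f).subtype ∘ₗ g) = LinearMap.ker g :=
        LinearMap.ker_comp_of_ker_eq_bot _ (LinearMap.ker f).ker_subtype
      have hfin : Module.Finite R (LinearMap.ker g) :=
        Module.Finite.of_injective ((LinearMap.ker g).subtype.restrictScalars R)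
          (LinearMap.ker g).injective_subtype
      have hproj : Module.Projective A (LinearMap.ker g) := by
        have hCM : IsCMModule R (LinearMap.ker ((LinearMap.ker f).subtype ∘ₗ g)) := by
          rw [hcomp]
          exact ⟨hfin, rs, hrs₁, hrs₂, h2⟩
        have := hM.projective_ker hR hEnd _ hCM
        rwa [hcomp] at this
      have hproj' : Projective (ModuleCat.of A (LinearMap.ker g)) :=
        (IsProjective.iff_projective _).1 hproj
      exact hasProjectiveDimensionLT_of_surjective f hf
        (hasProjectiveDimensionLT_of_surjective g hg inferInstance)
    | succ t ih =>
      intro j X _ _ _ _ _ hj hX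
      obtain ⟨a, f, hf⟩ := Module.Finite.exists_fin' A X
      exact hasProjectiveDimensionLT_of_surjective f hf
        (ih (j + 1) (LinearMap.ker f) (by omega) (hker f hf j hX))
  refine ⟨rs.length + 2, fun X => ?_⟩
  exact hasProjectiveDimensionLT_of_cyclic (rs.length + 2)
    (fun I => main rs.length 0 (A ⧸ I) (by omega) (by simp)) X

end GlobalDimensionEnd

/-! ### The noncommutative crepant resolution -/

section Resolution

variable {R S : Type u} [CommRing R]

theorem IsPureExtension.algebraMap_injective [CommRing S] [Algebra R S]
    (h : IsPureExtension R S) : Function.Injective (algebraMap R S) := by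
  obtain ⟨π, hπ⟩ := h
  exact Function.LeftInverse.injective (g := π) fun x => LinearMap.congr_fun hπ x

theorem IsPureExtension.inAdd [CommRing S] [Algebra R S] (h : IsPureExtension R S) :
    InAdd R S R := by
  obtain ⟨π, hπ⟩ := h
  exact InAdd.of_retract (Algebra.linearMap R S) π fun x => LinearMap.congr_fun hπ x

variable [IsDomain R] {p : ℕ} [Fact p.Prime] [CharP R p]

theorem IsFFinite.finite_frobeniusPushforward (hF : IsFFinite R p) :
    Module.Finite R (FrobeniusPushforward p 1 R) :=
  haveI : Module.Finite R (rootAlgebra R p 1) := hF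
  Module.Finite.equiv (rootAlgebraEquiv R p 1)

/-- For large `e`, each of `R^{1/q}` and the generator `M` is a summand of a power of the other, so
their endomorphism rings are Morita equivalent. -/
theorem IsCMGenerator.exists_forall_isMoritaEquivalent_isNCCR [IsLocalRing R]
    [IsNoetherianRing R] (hF : IsFFinite R p) [CommRing S]
    [Algebra R S] (hpure : IsPureExtension R S) {M : Type u} [AddCommGroup M]
    [Module R M] [Module S M] [IsScalarTower R S M] (hS : IsCMModule R S)
    (hM : IsCMGenerator R S M) (hEnd : IsCMModule R (Module.End R M))
    (hreg : IsStronglyFRegular R p) :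
    ∃ e₀ : ℕ, ∀ e : ℕ, e₀ ≤ e →
      IsMoritaEquivalent R (Module.End R (rootAlgebra R p e)) (Module.End R M) ∧
      IsNCCR R (rootAlgebra R p e) := by
  have : CharP S p := charP_of_injective_algebraMap hpure.algebraMap_injective p
  have hF' := hF.finite_frobeniusPushforward
  have hR : InAdd R M R := hpure.inAdd.trans (hM.2 S hS).restrictScalars
  have hnorm := hreg.isIntegrallyClosed
  have hMfin := hM.1.1
  obtain ⟨n, hn⟩ := exists_natCast_eq_ringKrullDim R
  have hrefl : Module.IsReflexive R M := ((isCMModule_iff hn).1 hM.1).2.isReflexive hn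
  obtain ⟨e₀, he₀⟩ := hM.exists_forall_inAdd hF' hS hpure hEnd hreg hR
  refine ⟨e₀, fun e he => ?_⟩
  have h1 : InAdd R (rootAlgebra R p e) M :=
    (he₀ e he).trans (InAdd.of_linearEquiv (rootAlgebraEquiv R p e).symm)
  have h2 : InAdd R M (rootAlgebra R p e) :=
    (InAdd.of_linearEquiv (rootAlgebraEquiv R p e)).trans
      (hM.inAdd_frobeniusPushforward hF' hS hpure e).2
  have hmor := isMoritaEquivalent_end R _ _ h2 h1
  have : FaithfulSMul R (AlgebraicClosure (FractionRing R)) :=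
    FaithfulSMul.trans R (FractionRing R) (AlgebraicClosure (FractionRing R))
  exact ⟨hmor, h2.finite, inferInstance, hEnd.of_inAdd (InAdd.hom h2 h2),
    .of_isMoritaEquivalent hmor.symm (hM.hasFiniteGlobalDimension_end hR hEnd)⟩

end Resolution

/-! ### Modules of large depth over a regular local ring -/

theorem HasDepthGE.of_isLocalHom {R S : Type*} [CommRing R] [IsLocalRing R] [CommRing S]
    [IsLocalRing S] [Algebra R S] [IsLocalHom (algebraMap R S)] {N : Type*} [AddCommGroup N]
    [Module R N] [Module S N] [IsScalarTower R S N] {n : ℕ} (h : HasDepthGE R N n) :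
    HasDepthGE S N n := by
  obtain ⟨rs, h₁, h₂, h₃⟩ := h
  refine ⟨rs.map (algebraMap R S), by simpa using h₁, ?_,
    (isWeaklyRegular_map_algebraMap_iff S N rs).2 h₃⟩
  intro s hs
  obtain ⟨r, hr, rfl⟩ := List.mem_map.1 hs
  exact map_nonunit (algebraMap R S) r (h₂ r hr)

/-- Modulo an element outside the square of the maximal ideal, the maximal ideal needs one generator
less. -/
theorem exists_span_range_eq_maximalIdeal_quotient {S : Type*} [CommRing S] [IsLocalRing S] {d : ℕ}
    {f : Fin (d + 1) → S} (hf : Ideal.span (Set.range f) = maximalIdeal S) {y : S}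
    (hy : y ∈ maximalIdeal S) (hy' : y ∉ maximalIdeal S ^ 2) [IsLocalRing (S ⧸ Ideal.span {y})] :
    ∃ g : Fin d → S ⧸ Ideal.span {y},
      Ideal.span (Set.range g) = maximalIdeal (S ⧸ Ideal.span {y}) := by
  have hfm : ∀ i, f i ∈ maximalIdeal S := fun i => hf ▸ Ideal.subset_span ⟨i, rfl⟩
  obtain ⟨a, ha⟩ := Ideal.mem_span_range_iff_exists_fun.1 (hf.symm ▸ hy)
  obtain ⟨i, hi⟩ : ∃ i, IsUnit (a i) := by
    by_contra! hcon
    refine hy' (ha ▸ Ideal.sum_mem _ fun i _ => ?_)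
    rw [pow_two]
    exact Ideal.mul_mem_mul (hcon i) (hfm i)
  let mk := Ideal.Quotient.mk (Ideal.span {y})
  have hmap : (maximalIdeal S).map mk = maximalIdeal (S ⧸ Ideal.span {y}) :=
    le_antisymm ((local_hom_TFAE mk).out 0 2 |>.1
        (IsLocalHom.of_surjective mk Ideal.Quotient.mk_surjective)) fun x hx => by
      obtain ⟨x, rfl⟩ := Ideal.Quotient.mk_surjective x
      exact Ideal.mem_map_of_mem mk ((mem_maximalIdeal x).2 fun hu =>
        (mem_maximalIdeal _).1 hx (hu.map mk))
  refine ⟨fun j => mk (f (i.succAbove j)), le_antisymm (Ideal.span_le.2 ?_) ?_⟩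
  · rintro _ ⟨j, rfl⟩
    exact hmap ▸ Ideal.mem_map_of_mem mk (hfm _)
  · rw [← hmap, ← hf, Ideal.map_span, Ideal.span_le]
    rintro _ ⟨_, ⟨k, rfl⟩, rfl⟩
    have hsub : ∀ j, mk (f (i.succAbove j)) ∈
        Ideal.span (Set.range fun j => mk (f (i.succAbove j))) :=
      fun j => Ideal.subset_span ⟨j, rfl⟩
    rcases Fin.eq_self_or_eq_succAbove i k with rfl | ⟨j, rfl⟩
    · have h0 : mk (a k) * mk (f k) + ∑ j, mk (a (k.succAbove j)) * mk (f (k.succAbove j)) = 0 := by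
        have : mk y = 0 := Ideal.Quotient.eq_zero_iff_mem.2 (Ideal.mem_span_singleton_self y)
        calc _ = mk (∑ i, a i * f i) := by simp [Fin.sum_univ_succAbove _ k]
          _ = 0 := by rw [ha, this]
      refine (Ideal.unit_mul_mem_iff_mem _ (hi.map mk)).1 ?_
      rw [eq_neg_of_add_eq_zero_left h0]
      exact neg_mem (Ideal.sum_mem _ fun j _ => Ideal.mul_mem_left _ _ (hsub j))
    · exact hsub j

/-- The special case of the Auslander-Buchsbaum formula that Cohen-Macaulay modules over a regular
local ring are free: one divides by a regular element outside the square of the maximal ideal. -/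
theorem HasDepthGE.free {S : Type u} [CommRing S] [IsLocalRing S] [IsNoetherianRing S]
    {N : Type u} [AddCommGroup N] [Module S N] [Module.Finite S N] {d : ℕ} {f : Fin d → S}
    (hf : Ideal.span (Set.range f) = maximalIdeal S) (h : HasDepthGE S N d) :
    Module.Free S N := by
  have hfree : maximalIdeal S = ⊥ → Module.Free S N := fun hbot => by
    let := ((isField_iff_maximalIdeal_eq).2 hbot).toField
    infer_instance
  induction d generalizing S N with
  | zero =>
    refine hfree ?_
    rw [← hf, Set.range_eq_empty, Ideal.span_empty]
  | succ d ih =>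
    by_cases hm : maximalIdeal S ≤ maximalIdeal S ^ 2
    · refine hfree (Submodule.eq_bot_of_le_smul_of_le_jacobson_bot (maximalIdeal S) _
        (IsNoetherian.noetherian _) ?_ (maximalIdeal_le_jacobson _))
      rwa [smul_eq_mul, ← pow_two]
    obtain ⟨y, hy, hy', hyN⟩ : ∃ y ∈ maximalIdeal S, y ∉ maximalIdeal S ^ 2 ∧
        IsSMulRegular N y := by
      by_contra! hcon
      have hsub : (maximalIdeal S : Set S) ⊆
          ⋃ P ∈ insert (maximalIdeal S ^ 2) (associatedPrimes S N), ((P : Ideal S) : Set S) := by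
        intro y hy
        simp only [Set.mem_insert_iff, Set.iUnion_iUnion_eq_or_left, Set.mem_union]
        by_cases hy' : y ∈ maximalIdeal S ^ 2
        · exact Or.inl hy'
        · right
          rw [biUnion_associatedPrimes_eq_compl_regular]
          exact hcon y hy hy'
      obtain ⟨P, hP, hmP⟩ := (Ideal.subset_union_prime_finite
        ((associatedPrimes.finite S N).insert _) (f := id) (maximalIdeal S ^ 2)
        (maximalIdeal S ^ 2) fun P hP hne _ =>
          (Set.mem_of_mem_insert_of_ne hP hne).isPrime).1 hsub
      rcases hP with rfl | hP
      · exact hm hmP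
      · obtain ⟨r, hr, hrN, -⟩ := hasDepthGE_succ_iff.1 h
        have : r ∈ ⋃ P ∈ associatedPrimes S N, (P : Set S) :=
          Set.mem_biUnion hP (hmP hr)
        rw [biUnion_associatedPrimes_eq_compl_regular] at this
        exact this hrN
    have : Nontrivial (S ⧸ Ideal.span {y}) := Ideal.Quotient.nontrivial_iff.2 fun htop =>
      (mem_maximalIdeal y).1 hy (Ideal.span_singleton_eq_top.1 htop)
    have : IsLocalRing (S ⧸ Ideal.span {y}) :=
      .of_surjective' (Ideal.Quotient.mk _) Ideal.Quotient.mk_surjective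
    have : IsLocalHom (algebraMap S (S ⧸ Ideal.span {y})) :=
      IsLocalHom.of_surjective _ Ideal.Quotient.mk_surjective
    obtain ⟨g, hg⟩ := exists_span_range_eq_maximalIdeal_quotient hf hy hy'
    have := Module.finitePresentation_of_finite S N
    rw [← Module.free_quotSMulTop_iff_free S N (maximalIdeal_le_jacobson _ hy) hyN]
    have := Module.Finite.of_restrictScalars_finite S (S ⧸ Ideal.span {y}) (QuotSMulTop y N)
    refine ih hg (h.quotSMulTop hy hyN).of_isLocalHom fun hbot => ?_
    let := ((isField_iff_maximalIdeal_eq).2 hbot).toField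
    infer_instance

theorem Submodule.FG.exists_span_range_eq {R M : Type*} [Semiring R] [AddCommMonoid M] [Module R M]
    {P : Submodule R M} (hP : P.FG) {n : ℕ} (hn : P.spanFinrank ≤ n) :
    ∃ f : Fin n → M, Submodule.span R (Set.range f) = P := by
  obtain ⟨s, hs, rfl⟩ := hP.exists_span_finset_card_eq_spanFinrank
  refine ⟨fun j => if h : j.1 < s.card then s.equivFin.symm ⟨j, h⟩ else 0,
    le_antisymm (Submodule.span_le.2 ?_) (Submodule.span_le.2 fun x hx => ?_)⟩
  · rintro _ ⟨j, rfl⟩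
    by_cases h : j.1 < s.card
    · simpa [h] using Submodule.subset_span (s.equivFin.symm ⟨j, h⟩).2
    · simp [h]
  · have hlt := (s.equivFin ⟨x, hx⟩).2
    exact Submodule.subset_span ⟨⟨s.equivFin ⟨x, hx⟩, by omega⟩, by simp⟩

theorem ringKrullDim_le_of_isIntegral (R S : Type*) [CommRing R] [CommRing S] [Algebra R S]
    [Algebra.IsIntegral R S] : ringKrullDim S ≤ ringKrullDim R :=
  Order.krullDim_le_of_strictMono (PrimeSpectrum.comap (algebraMap R S)) fun _ _ h =>
    Ideal.IsIntegral.comap_lt_comap h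

section Regular

variable {R S : Type u} [CommRing R] [IsLocalRing R] [IsNoetherianRing R] [CommRing S]
  [Algebra R S] [Module.Finite R S]

/-- The ring `S` may have smaller dimension than `R` a priori, so its maximal ideal is generated by
at most `dim R` elements, as many as the depth of `N`. -/
theorem IsCMModule.free_of_isRegularLocalRing [IsRegularLocalRing S]
    (hinj : Function.Injective (algebraMap R S)) {N : Type u} [AddCommGroup N] [Module R N]
    [Module S N] [IsScalarTower R S N] (hN : IsCMModule R N) : Module.Free S N := by
  obtain ⟨n, hn⟩ := exists_natCast_eq_ringKrullDim R
  rw [isCMModule_iff hn] at hN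
  have := hN.1
  have : Module.Finite S N := .of_restrictScalars_finite R S N
  have : FaithfulSMul R S := (faithfulSMul_iff_algebraMap_injective R S).2 hinj
  have hle : (maximalIdeal S).spanFinrank ≤ n := by
    have h := ringKrullDim_le_of_isIntegral R S
    rw [← IsRegularLocalRing.spanFinrank_maximalIdeal, ← hn] at h
    exact_mod_cast h
  obtain ⟨f, hf⟩ := (IsNoetherian.noetherian (maximalIdeal S)).exists_span_range_eq hle
  exact HasDepthGE.free hf hN.2.of_isLocalHom

/-- The module `S = Hom_R(R, S)` is a summand of `End_R(S)`, and Cohen-Macaulay `S`-modules are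
free. -/
theorem IsRegularLocalRing.isCMGenerator (hreg : IsRegularLocalRing S) (hpure : IsPureExtension R S)
    (hEnd : IsCMModule R (Module.End R S)) : IsCMGenerator R S S := by
  refine ⟨hEnd.of_inAdd (.trans (.of_linearEquiv (LinearMap.ringLmapEquivSelf R R S).symm)
    (.hom_left S hpure.inAdd)), fun N _ _ _ _ hN => ?_⟩
  have := hN.free_of_isRegularLocalRing hpure.algebraMap_injective
  have := hN.1
  have : Module.Finite S N := .of_restrictScalars_finite R S N
  have e := (Module.finBasis S N).equivFun
  exact .trans (.of_linearEquiv e) (.pi _)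

variable [IsDomain R] {p : ℕ} [Fact p.Prime] [CharP R p]

open FrobeniusPushforward

/-- The `S`-module `F^e_* S` is free, and for large `e` Krull's intersection theorem shows that a
given nonzero element of it has a unit among its coordinates. -/
theorem IsStronglyFRegular.of_isRegularLocalRing [IsRegularLocalRing S] (hF : IsFFinite R p)
    (hpure : IsPureExtension R S) (hS : IsCMModule R S) : IsStronglyFRegular R p := by
  have hinj := hpure.algebraMap_injective
  have : CharP S p := charP_of_injective_algebraMap hinj p
  obtain ⟨π, hπ⟩ := hpure
  rw [isStronglyFRegular_iff]
  intro c hc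
  have hc' : algebraMap R S c ≠ 0 := (map_ne_zero_iff _ hinj).2 hc
  obtain ⟨e, he⟩ : ∃ e, algebraMap R S c ∉ maximalIdeal S ^ e := by
    by_contra! hcon
    refine hc' ?_
    rw [← Ideal.mem_bot, ← Ideal.iInf_pow_eq_bot_of_isLocalRing (maximalIdeal S)
      Ideal.IsPrime.ne_top']
    exact (Submodule.mem_iInf _).2 hcon
  have hcm := hS.frobeniusPushforward hF.finite_frobeniusPushforward e
  have hfree : Module.Free S (FrobeniusPushforward p e S) := hcm.free_of_isRegularLocalRing hinj
  have hfin := hcm.1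
  have : Module.Finite S (FrobeniusPushforward p e S) := .of_restrictScalars_finite R S _
  let b := Module.finBasis S (FrobeniusPushforward p e S)
  let x : FrobeniusPushforward p e S := of p e S (algebraMap R S c)
  obtain ⟨i, hi⟩ : ∃ i, IsUnit (b.repr x i) := by
    by_contra! hcon
    have hsum : algebraMap R S c = ∑ i, (b.repr x i) ^ p ^ e * (of p e S).symm (b i) := by
      change (of p e S).symm x = _
      conv_lhs => rw [← b.sum_repr x, map_sum]
      rfl
    refine he (hsum ▸ Ideal.sum_mem _ fun i _ => Ideal.mul_mem_right _ _ ?_)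
    exact Ideal.pow_le_pow_right (Nat.lt_pow_self (Fact.out : p.Prime).one_lt).le
      (Ideal.pow_mem_pow (hcon i) _)
  obtain ⟨u, hu⟩ := hi.exists_right_inv
  let φ : FrobeniusPushforward p e S →ₗ[R] S :=
    (LinearMap.toSpanSingleton S S u ∘ₗ b.coord i).restrictScalars R
  refine ⟨e, π ∘ₗ φ ∘ₗ map p e (Algebra.linearMap R S), ?_⟩
  have hφ : φ x = 1 := hu
  have hπ1 : π (1 : S) = 1 := by simpa using LinearMap.congr_fun hπ 1
  change π (φ x) = 1
  rw [hφ, hπ1]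

end Regular

theorem mainTheorem4 {R S : Type u} [CommRing R] [IsDomain R] [IsLocalRing R] [IsNoetherianRing R]
    [IsAdicComplete (IsLocalRing.maximalIdeal R) R]
    (p : ℕ) [Fact p.Prime] [CharP R p] (hF : IsFFinite R p)
    [CommRing S] [Algebra R S] [Module.Finite R S] (hpure : IsPureExtension R S) :
    (∀ (M : Type u) [AddCommGroup M] [Module R M] [Module S M] [IsScalarTower R S M],
      IsCMModule R S → IsOfFiniteCMType R S → IsCMGenerator R S M →
      IsCMModule R (Module.End R M) → IsStronglyFRegular R p →
      ∃ e₀ : ℕ, ∀ e : ℕ, e₀ ≤ e →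
        IsMoritaEquivalent R (Module.End R (rootAlgebra R p e)) (Module.End R M) ∧
        IsNCCR R (rootAlgebra R p e)) ∧
    (IsRegularLocalRing S → IsCMModule R (Module.End R S) →
      ∃ e₀ : ℕ, ∀ e : ℕ, e₀ ≤ e →
        IsMoritaEquivalent R (Module.End R (rootAlgebra R p e)) (Module.End R S) ∧
        IsNCCR R (rootAlgebra R p e)) := by
  refine ⟨fun M _ _ _ _ hS _ hM hEnd hreg =>
    hM.exists_forall_isMoritaEquivalent_isNCCR hF hpure hS hEnd hreg, fun hS hEnd => ?_⟩
  have hgen := hS.isCMGenerator hpure hEnd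
  exact hgen.exists_forall_isMoritaEquivalent_isNCCR hF hpure hgen.1 hEnd
    (.of_isRegularLocalRing hF hpure hgen.1)
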